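/- **Theorem 2.2.** Let $\Omega\subset\mathbb C^n$ be a pseudoconvex domain with $C^2$ boundary $b\Omega$, let $z_o\in b\Omega$, and let $r$ be a $C^2$ defining function of $\Omega$ near $z_o$ (so $\Omega=\{r<0\}$ near $z_o$ and $dr\neq 0$ where $r=0$). Let $G$ be a real-valued function that is nonnegative and increasing (in the weak sense) on some interval $(0,a)$, $a>0$. Suppose that there are constants $c_1,c_2>0$ and $\eta\in(0,1]$, an open neighbourhood $V$ of $z_o$, and a plurisubharmonic function $\psi$ on $V\cap\Omega$ such that $$-c_1|z-z_o|^\eta\le\psi(z)\le -G(c_2|z-z_o|)^\eta\qquad\text{for all } z\in V\cap\Omega.$$ Let $Z$ be a one-dimensional complex analytic variety through $z_o$, and suppose that $b\Omega$ has type $\le F$ along $Z$ at $z_o$, that is, $F$ is a real-valued function with $$|r(z)|\le F(|z-z_o|)\qquad\text{for all } z\in Z\setminus\{z_o\}\text{ sufficiently close to } z_o.$$ Then there are constants $\alpha,\beta>0$ such that $$F(\delta)\ \ge\ \beta\,G(\alpha\delta)\qquad\text{for all sufficiently small }\delta>0.$$ -/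

import Mathlib

open Set Filter Topology

/-- Complex Euclidean space `ℂⁿ`, with its Euclidean norm. -/
abbrev Cn (n : ℕ) : Type := EuclideanSpace ℂ (Fin n)

/-- A (finite-valued) function `u` is plurisubharmonic on `S`: it is upper semicontinuous on `S`, and
it satisfies the sub-mean value inequality on every closed affine complex disc contained in `S`.
The means of a plurisubharmonic function that is nowhere `-∞` are finite, so integrability on the
circles is part of the notion. -/
def IsPlurisubharmonicOn {n : ℕ} (u : Cn n → ℝ) (S : Set (Cn n)) : Prop :=
  UpperSemicontinuousOn u S ∧
    ∀ z w : Cn n, (∀ t : ℂ, ‖t‖ ≤ 1 → z + t • w ∈ S) →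
      CircleIntegrable (fun t : ℂ => u (z + t • w)) 0 1 ∧
        u z ≤ Real.circleAverage (fun t : ℂ => u (z + t • w)) 0 1

/-- An open set is pseudoconvex if minus the logarithm of the distance to the boundary
(equivalently, to the complement) is plurisubharmonic in it. -/
def IsPseudoconvex {n : ℕ} (Ω : Set (Cn n)) : Prop :=
  IsPlurisubharmonicOn (fun z => -Real.log (Metric.infDist z Ωᶜ)) Ω

/-- `r` is a `C²` defining function of `Ω` near `p`: it is of class `C²` in a neighbourhood `U` of
`p`, one has `Ω ∩ U = {z ∈ U | r z < 0}`, and `dr ≠ 0` on `{z ∈ U | r z = 0}`. -/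
def IsC2DefiningFunctionAt {n : ℕ} (Ω : Set (Cn n)) (r : Cn n → ℝ) (p : Cn n) : Prop :=
  ∃ U : Set (Cn n), IsOpen U ∧ p ∈ U ∧ ContDiffOn ℝ 2 r U ∧
    (∀ z ∈ U, z ∈ Ω ↔ r z < 0) ∧ ∀ z ∈ U, r z = 0 → fderiv ℝ r z ≠ 0

/-- The boundary of `Ω` is of class `C²`. -/
def HasC2Boundary {n : ℕ} (Ω : Set (Cn n)) : Prop :=
  ∀ p ∈ frontier Ω, ∃ r : Cn n → ℝ, IsC2DefiningFunctionAt Ω r p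

/-- In a neighbourhood of `p`, the set `Z` is the set of common zeros of finitely many holomorphic
functions. -/
def IsAnalyticSetNear {n : ℕ} (Z : Set (Cn n)) (p : Cn n) : Prop :=
  ∃ W : Set (Cn n), IsOpen W ∧ p ∈ W ∧ ∃ (m : ℕ) (f : Fin m → Cn n → ℂ),
    (∀ i, DifferentiableOn ℂ (f i) W) ∧ Z ∩ W = {z ∈ W | ∀ i, f i z = 0}

/-- `p` is a regular point of `Z` of dimension `d`: near `p` the set `Z` is a complex submanifold of
`ℂⁿ` of complex dimension `d`, that is, the zero set of a holomorphic submersion to `ℂᵏ`, where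
`k + d = n`. -/
def IsRegularPointOfDim {n : ℕ} (Z : Set (Cn n)) (d : ℕ) (p : Cn n) : Prop :=
  p ∈ Z ∧ ∃ k : ℕ, k + d = n ∧ ∃ W : Set (Cn n), IsOpen W ∧ p ∈ W ∧
    ∃ f : Cn n → Cn k, DifferentiableOn ℂ f W ∧ Function.Surjective (fderiv ℂ f p) ∧
      Z ∩ W = {z ∈ W | f z = 0}

/-- The analytic set `Z` has dimension `d` at `p`: the largest `d` such that regular points of
dimension `d` accumulate at (or equal) `p`. -/
def HasDimAt {n : ℕ} (Z : Set (Cn n)) (d : ℕ) (p : Cn n) : Prop :=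
  p ∈ closure {q | IsRegularPointOfDim Z d q} ∧
    ∀ᶠ q in 𝓝 p, ∀ d' : ℕ, IsRegularPointOfDim Z d' q → d' ≤ d

/-- `Z` is (near `p`) a one-dimensional complex analytic variety through `p`. -/
def IsComplexCurveThrough {n : ℕ} (Z : Set (Cn n)) (p : Cn n) : Prop :=
  p ∈ Z ∧ IsAnalyticSetNear Z p ∧ HasDimAt Z 1 p

/-- The boundary defined by `r` has type `≤ F` along `Z` at `p`: `|r(z)| ≤ F(|z - p|)` for `z ∈ Z`
tending to `p`. -/
def HasTypeLEAlong {n : ℕ} (r : Cn n → ℝ) (Z : Set (Cn n)) (p : Cn n) (F : ℝ → ℝ) : Prop :=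
  ∀ᶠ z in 𝓝[Z \ {p}] p, |r z| ≤ F ‖z - p‖

/-!
Let `z₀ = 0` and let `ν` be an inner unit direction. For `x ∈ Z` with `‖x‖ = δ` one has
`r x ≤ F δ`, so the translates `x + s ν` with `F δ < c s` lie in `Ω`. If the translate of a piece of
`Z ∩ {‖x‖ ≤ δ}` lies in `Ω` as well, then the maximum principle for `ψ` along this piece compares
its values near the centre, at least `-c₁ (2 s) ^ η`, with those at the rim, at most
`-G (c₂ δ / 2) ^ η`; letting `s` decrease to `F δ / c` gives the estimate. That the whole translated
piece lies in `Ω` is the continuity principle (`IsPseudoconvex.add_smul_mem`): it does for `s`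
comparable to `δ`, and when `s` decreases the maximum principle for `-log dist(·, Ωᶜ)` keeps the
piece as far from the complement as its rim.

Everything thus rests on the maximum principle for plurisubharmonic functions along `Z`, at points
arbitrarily near `z₀`, in the presence of singularities
(`IsComplexCurveThrough.exists_maximum_principle`). It has two ingredients.

* `IsPlurisubharmonicOn.not_isMax_on_zeroLocus`: on the zero locus of a holomorphic map `H` with
  nowhere injective differential, a strictly plurisubharmonic function has no local maximum. Only
  affine discs are used, thanks to a penalization by `-N ‖H‖²`. A small multiple of `log |J|` is
  added in `IsPlurisubharmonicOn.le_of_forall_mem_boundary_le` to keep the maximum away from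
  `{J = 0}`.
* `exists_foliation_analyticHull`: the local structure of analytic sets is bypassed as follows. Take
  a small smooth piece `S` of `Z` near `z₀`, and the common zeros of all functions that are
  holomorphic on a fixed neighbourhood and vanish on `S`. This hull is contained in `Z`. A maximal
  set of functions in the ideal of `S` with independent differentials yields a vector field that
  preserves the ideal. Along its integral curves through points of the hull the functions in the
  ideal vanish to infinite order, so the hull is foliated by these curves where the relevant
  determinant `J` does not vanish. As `J` is not identically zero on `S`, the estimate is available
  at a point of `S`.
-/

/-! ### Holomorphic functions of several variables -/

section SeveralVariables

variable {E : Type*} [NormedAddCommGroup E] [NormedSpace ℂ E]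

lemma hasDerivAt_comp_line {F : Type*} [NormedAddCommGroup F] [NormedSpace ℂ F]
    {f : E → F} {z w : E} {t : ℂ} (hf : DifferentiableAt ℂ f (z + t • w)) :
    HasDerivAt (fun s : ℂ => f (z + s • w)) (fderiv ℂ f (z + t • w) w) t := by
  have h1 : HasDerivAt (fun s : ℂ => z + s • w) w t := by
    simpa using ((hasDerivAt_id t).smul_const w).const_add z
  exact hf.hasFDerivAt.comp_hasDerivAt t h1

/-- The Cauchy estimate for the differential. -/
lemma norm_fderiv_le_of_forall_mem_closedBall {f : E → ℂ} {U : Set E} (hU : IsOpen U)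
    (hf : DifferentiableOn ℂ f U) {z : E} {r M : ℝ} (hr : 0 < r)
    (hsub : Metric.closedBall z r ⊆ U) (hM : ∀ x ∈ Metric.closedBall z r, ‖f x‖ ≤ M) :
    ‖fderiv ℂ f z‖ ≤ M / r := by
  have hzU : z ∈ U := hsub (Metric.mem_closedBall_self hr.le)
  have hM0 : 0 ≤ M := (norm_nonneg _).trans (hM z (Metric.mem_closedBall_self hr.le))
  refine ContinuousLinearMap.opNorm_le_bound _ (by positivity) fun w => ?_
  rcases eq_or_ne w 0 with rfl | hw
  · simp
  have hw' : 0 < ‖w‖ := norm_pos_iff.2 hw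
  have hmem : ∀ t ∈ Metric.closedBall (0 : ℂ) (r / ‖w‖), z + t • w ∈ Metric.closedBall z r := by
    intro t ht
    rw [mem_closedBall_zero_iff, le_div_iff₀ hw'] at ht
    simpa [norm_smul] using ht
  have hd : DifferentiableOn ℂ (fun t : ℂ => f (z + t • w)) (Metric.closedBall 0 (r / ‖w‖)) :=
    fun t ht => (hasDerivAt_comp_line (hf.differentiableAt (hU.mem_nhds (hsub (hmem t ht))))).differentiableAt.differentiableWithinAt
  have hd' : DiffContOnCl ℂ (fun t : ℂ => f (z + t • w)) (Metric.ball 0 (r / ‖w‖)) :=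
    hd.diffContOnCl_ball subset_rfl
  have h := Complex.norm_deriv_le_of_forall_mem_sphere_norm_le (by positivity) hd'
    (fun t ht => hM _ (hmem t (Metric.sphere_subset_closedBall ht)))
  have hz : DifferentiableAt ℂ f (z + (0 : ℂ) • w) := by
    simpa using hf.differentiableAt (hU.mem_nhds hzU)
  rw [(hasDerivAt_comp_line hz).deriv] at h
  simpa [div_div_eq_mul_div, mul_comm, mul_div_assoc, div_mul_eq_mul_div] using h

/-- Cauchy's formula writes a directional derivative as an integral over a circle, which can be
differentiated under the integral sign. -/
lemma differentiableOn_fderiv_apply_scalar [FiniteDimensional ℂ E] {f : E → ℂ} {U : Set E}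
    (hU : IsOpen U) (hf : DifferentiableOn ℂ f U) (w : E) :
    DifferentiableOn ℂ (fun z => fderiv ℂ f z w) U := by
  have : ProperSpace E := FiniteDimensional.proper ℂ E
  let : MeasurableSpace E := borel E
  have : BorelSpace E := ⟨rfl⟩
  intro z₀ hz₀
  obtain ⟨r, hr, hrU⟩ := Metric.nhds_basis_closedBall.mem_iff.1 (hU.mem_nhds hz₀)
  obtain ⟨M, hM⟩ := (isCompact_closedBall z₀ r).exists_bound_of_continuousOn
    (hf.continuousOn.mono hrU)
  have hM0 : 0 ≤ M := (norm_nonneg _).trans (hM z₀ (Metric.mem_closedBall_self hr.le))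
  have hbd : ∀ x ∈ Metric.closedBall z₀ (r / 2), ‖fderiv ℂ f x‖ ≤ M / (r / 2) := by
    intro x hx
    have hsub : Metric.closedBall x (r / 2) ⊆ Metric.closedBall z₀ r :=
      Metric.closedBall_subset_closedBall' (by
        have := Metric.mem_closedBall.1 hx; linarith)
    exact norm_fderiv_le_of_forall_mem_closedBall hU hf (by positivity) (hsub.trans hrU)
      fun y hy => hM y (hsub hy)
  set ρ : ℝ := r / 4 / (‖w‖ + 1) with hρdef
  have hρ : 0 < ρ := by positivity
  have hρw : ρ * ‖w‖ ≤ r / 4 := by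
    rw [hρdef, div_mul_eq_mul_div, div_le_iff₀ (by positivity)]
    nlinarith [norm_nonneg w]
  have hmem : ∀ x ∈ Metric.closedBall z₀ (r / 4), ∀ t : ℂ, ‖t‖ ≤ ρ →
      x + t • w ∈ Metric.closedBall z₀ (r / 2) := by
    intro x hx t ht
    rw [Metric.mem_closedBall, dist_eq_norm] at hx ⊢
    calc ‖x + t • w - z₀‖ = ‖(x - z₀) + t • w‖ := by congr 1; abel
      _ ≤ ‖x - z₀‖ + ‖t‖ * ‖w‖ := by simpa [norm_smul] using norm_add_le (x - z₀) (t • w)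
      _ ≤ r / 4 + ρ * ‖w‖ := by gcongr
      _ ≤ r / 2 := by linarith
  have hmemU : ∀ x ∈ Metric.closedBall z₀ (r / 4), ∀ t : ℂ, ‖t‖ ≤ ρ → x + t • w ∈ U :=
    fun x hx t ht => hrU (Metric.closedBall_subset_closedBall (by linarith) (hmem x hx t ht))
  set k : ℝ → ℂ := fun θ => deriv (circleMap 0 ρ) θ * ((circleMap 0 ρ θ - 0) ^ 2)⁻¹ with hk
  have hcm : ∀ θ, ‖circleMap 0 ρ θ‖ ≤ ρ := fun θ => by simp [abs_of_pos hρ]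
  have hkc : Continuous k := by
    simp only [hk, deriv_circleMap, sub_zero]
    refine (by fun_prop : Continuous fun θ => circleMap 0 ρ θ * Complex.I).mul
      (Continuous.inv₀ (by fun_prop) fun θ => ?_)
    simp [hρ.ne']
  have hkn : ∀ θ, ‖k θ‖ = ρ * (ρ ^ 2)⁻¹ := fun θ => by simp [hk, abs_of_pos hρ]
  have hfc : ∀ x ∈ Metric.closedBall z₀ (r / 4),
      Continuous fun θ : ℝ => k θ • f (x + circleMap 0 ρ θ • w) := by
    intro x hx
    refine hkc.smul (hf.continuousOn.comp_continuous (by fun_prop) fun θ =>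
      hmemU x hx _ (hcm θ))
  have key := intervalIntegral.hasFDerivAt_integral_of_dominated_of_fderiv_le (𝕜 := ℂ)
    (μ := MeasureTheory.volume) (a := 0) (b := 2 * Real.pi)
    (F := fun (x : E) (θ : ℝ) => k θ • f (x + circleMap 0 ρ θ • w))
    (F' := fun (x : E) (θ : ℝ) => k θ • fderiv ℂ f (x + circleMap 0 ρ θ • w))
    (x₀ := z₀) (s := Metric.closedBall z₀ (r / 4))
    (bound := fun _ => ρ * (ρ ^ 2)⁻¹ * (M / (r / 2)))
    (Metric.closedBall_mem_nhds z₀ (by positivity))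
    (by
      filter_upwards [Metric.closedBall_mem_nhds z₀ (show 0 < r / 4 by positivity)] with x hx
      exact (hfc x hx).aestronglyMeasurable)
    ((hfc z₀ (Metric.mem_closedBall_self (by positivity))).intervalIntegrable _ _)
    (by
      refine hkc.aestronglyMeasurable.smul ?_
      have h1 : Measurable fun θ : ℝ => fderiv ℂ f (z₀ + circleMap 0 ρ θ • w) :=
        (measurable_fderiv ℂ f).comp
          (by fun_prop : Continuous fun θ : ℝ => z₀ + circleMap 0 ρ θ • w).measurable
      exact h1.aestronglyMeasurable)
    (by
      refine Eventually.of_forall fun θ _ x hx => ?_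
      rw [norm_smul, hkn]
      gcongr
      exact hbd _ (hmem x hx _ (hcm θ)))
    intervalIntegrable_const
    (by
      refine Eventually.of_forall fun θ _ x hx => ?_
      have h1 := (hf.differentiableAt (hU.mem_nhds (hmemU x hx _ (hcm θ)))).hasFDerivAt
      have h2 : HasFDerivAt (fun y : E => y + circleMap 0 ρ θ • w)
          (ContinuousLinearMap.id ℂ E) x := (hasFDerivAt_id x).add_const _
      have h3 := (h1.comp x h2).const_smul (k θ)
      rw [ContinuousLinearMap.comp_id] at h3
      exact h3)
  have heq : ∀ᶠ x in 𝓝 z₀, fderiv ℂ f x w = (2 * ↑Real.pi * Complex.I)⁻¹ •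
      ∫ θ in (0 : ℝ)..2 * Real.pi, k θ • f (x + circleMap 0 ρ θ • w) := by
    filter_upwards [Metric.closedBall_mem_nhds z₀ (show 0 < r / 4 by positivity)] with x hx
    have hUo : IsOpen {t : ℂ | x + t • w ∈ U} :=
      hU.preimage (by fun_prop : Continuous fun t : ℂ => x + t • w)
    have hd : DifferentiableOn ℂ (fun t : ℂ => f (x + t • w)) {t : ℂ | x + t • w ∈ U} :=
      fun t ht => (hasDerivAt_comp_line (hf.differentiableAt (hU.mem_nhds ht))).differentiableAt.differentiableWithinAt
    have h := Complex.two_pi_I_inv_smul_circleIntegral_sub_sq_inv_smul_of_differentiable hUo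
      (c := 0) (w₀ := 0) (R := ρ)
      (fun t ht => hmemU x hx t (by simpa using ht)) hd (Metric.mem_ball_self hρ)
    have hz : DifferentiableAt ℂ f (x + (0 : ℂ) • w) :=
      hf.differentiableAt (hU.mem_nhds (hmemU x hx 0 (by simpa using hρ.le)))
    rw [(hasDerivAt_comp_line hz).deriv] at h
    simp only [zero_smul, add_zero] at h
    rw [← h, circleIntegral]
    simp only [hk, smul_smul]
  exact ((key.const_smul (2 * ↑Real.pi * Complex.I)⁻¹).congr_of_eventuallyEq
    (f₁ := fun x => fderiv ℂ f x w) heq).differentiableAt.differentiableWithinAt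

lemma differentiableOn_fderiv_of_apply {n : ℕ} {F : Type*} [NormedAddCommGroup F]
    [NormedSpace ℂ F] {f : Cn n → F} {U : Set (Cn n)}
    (hf : ∀ v, DifferentiableOn ℂ (fun z => fderiv ℂ f z v) U) :
    DifferentiableOn ℂ (fderiv ℂ f) U := by
  have h : fderiv ℂ f = fun z => ∑ i, ContinuousLinearMap.smulRightL ℂ (Cn n) F
      (EuclideanSpace.proj i : Cn n →L[ℂ] ℂ) (fderiv ℂ f z (EuclideanSpace.single i 1)) := by
    ext z v
    conv_lhs => rw [← (EuclideanSpace.basisFun (Fin n) ℂ).sum_repr v]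
    simp
  rw [h]
  exact DifferentiableOn.fun_sum fun i _ =>
    (ContinuousLinearMap.differentiable _).comp_differentiableOn (hf _)

lemma differentiableOn_fderiv {n : ℕ} {f : Cn n → ℂ} {U : Set (Cn n)}
    (hU : IsOpen U) (hf : DifferentiableOn ℂ f U) : DifferentiableOn ℂ (fderiv ℂ f) U :=
  differentiableOn_fderiv_of_apply fun v => differentiableOn_fderiv_apply_scalar hU hf v

lemma differentiableOn_fderiv_apply {n k : ℕ} {f : Cn n → Cn k} {U : Set (Cn n)}
    (hU : IsOpen U) (hf : DifferentiableOn ℂ f U) (v : Cn n) :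
    DifferentiableOn ℂ (fun z => fderiv ℂ f z v) U := by
  refine differentiableOn_euclidean.2 fun i => ?_
  refine ((differentiableOn_fderiv_apply_scalar hU (differentiableOn_euclidean.1 hf i) v)).congr fun z hz => ?_
  have h3 : HasFDerivAt (fun x => f x i)
      ((EuclideanSpace.proj i : Cn k →L[ℂ] ℂ) ∘L fderiv ℂ f z) z :=
      (EuclideanSpace.proj i : Cn k →L[ℂ] ℂ).hasFDerivAt.comp z
        (hf.differentiableAt (hU.mem_nhds hz)).hasFDerivAt
  rw [h3.fderiv]; rfl

lemma hasStrictFDerivAt_of_differentiableOn {n k : ℕ} {f : Cn n → Cn k} {U : Set (Cn n)}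
    (hU : IsOpen U) (hf : DifferentiableOn ℂ f U) {z : Cn n} (hz : z ∈ U) :
    HasStrictFDerivAt f (fderiv ℂ f z) z := by
  have h1 : ∀ᶠ x in 𝓝 z, HasFDerivAt f (fderiv ℂ f x) x := by
    filter_upwards [hU.mem_nhds hz] with x hx
    exact (hf.differentiableAt (hU.mem_nhds hx)).hasFDerivAt
  exact hasStrictFDerivAt_of_hasFDerivAt_of_continuousAt h1
    ((differentiableOn_fderiv_of_apply fun v =>
      differentiableOn_fderiv_apply hU hf v).differentiableAt (hU.mem_nhds hz)).continuousAt

end SeveralVariables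

/-! ### Plurisubharmonic functions on holomorphic curves -/

section Plurisubharmonic

variable {n : ℕ}

lemma IsPlurisubharmonicOn.mono {u : Cn n → ℝ} {S T : Set (Cn n)}
    (hu : IsPlurisubharmonicOn u T) (hST : S ⊆ T) : IsPlurisubharmonicOn u S :=
  ⟨hu.1.mono hST, fun z w h => hu.2 z w fun t ht => hST (h t ht)⟩

lemma IsPlurisubharmonicOn.comp_add_const {u : Cn n → ℝ} {S : Set (Cn n)}
    (hu : IsPlurisubharmonicOn u S) (v : Cn n) :
    IsPlurisubharmonicOn (fun z => u (z + v)) {z | z + v ∈ S} := by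
  constructor
  · intro z hz
    exact (hu.1 (z + v) hz).comp (g := fun z : Cn n => z + v)
      (by fun_prop : Continuous fun z : Cn n => z + v).continuousWithinAt (fun _ h => h)
  · intro z w h
    have := hu.2 (z + v) w fun t ht => by simpa [add_right_comm] using h t ht
    simpa [add_right_comm] using this

/-- A plurisubharmonic function dominated by a pluriharmonic one on the boundary of an affine disc
is dominated by it at the centre. -/
lemma IsPlurisubharmonicOn.le_re_of_forall_le_re {u : Cn n → ℝ} {S : Set (Cn n)}
    (hu : IsPlurisubharmonicOn u S) {z w : Cn n} (hS : ∀ t : ℂ, ‖t‖ ≤ 1 → z + t • w ∈ S)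
    {g : ℂ → ℂ} (hg : DifferentiableOn ℂ g (Metric.closedBall 0 1))
    (hle : ∀ t : ℂ, ‖t‖ = 1 → u (z + t • w) ≤ (g t).re) : u z ≤ (g 0).re := by
  obtain ⟨hi, hm⟩ := hu.2 z w hS
  have hgi : CircleIntegrable g 0 1 :=
    (hg.continuousOn.mono Metric.sphere_subset_closedBall).circleIntegrable zero_le_one
  have hgc : Real.circleAverage g 0 1 = g 0 :=
    DiffContOnCl.circleAverage (by simpa using hg.diffContOnCl_ball subset_rfl)
  have h1 := Complex.reCLM.circleAverage_comp_comm hgi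
  have hre : CircleIntegrable (Complex.reCLM ∘ g) 0 1 :=
    (Complex.reCLM.continuous.comp_continuousOn
      (hg.continuousOn.mono Metric.sphere_subset_closedBall)).circleIntegrable zero_le_one
  calc u z ≤ Real.circleAverage (fun t : ℂ => u (z + t • w)) 0 1 := hm
    _ ≤ Real.circleAverage (Complex.reCLM ∘ g) 0 1 :=
      Real.circleAverage_mono hi hre fun t ht => hle t (by simpa using ht)
    _ = (g 0).re := by rw [h1, hgc]; rfl

/-- A strictly plurisubharmonic function `w + ε‖· - a‖²` has no local maximum on the zero locus of
a holomorphic map `H` whose differential is nowhere injective.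

The point of the argument is that it needs no parametrization of the zero locus: one maximizes the
penalized function `w + ε‖· - a‖² - N‖H‖²` on a full ball. On a small affine disc in the direction
of the kernel of `dH`, the penalty is the real part of a holomorphic function up to an error of
order `o(ρ²)`, which the strictly plurisubharmonic term beats. -/
lemma IsPlurisubharmonicOn.not_isMax_on_zeroLocus {w : Cn n → ℝ} {O : Set (Cn n)}
    (hO : IsOpen O) (hw : IsPlurisubharmonicOn w O) {H : Cn n → Cn n}
    (hH : DifferentiableOn ℂ H O) (hker : ∀ x ∈ O, ∃ v ≠ 0, fderiv ℂ H x v = 0)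
    {z a : Cn n} (hz : z ∈ O) (hHz : H z = 0) {ε : ℝ} (hε : 0 < ε)
    (hmax : ∀ x ∈ O, H x = 0 → w x + ε * ‖x - a‖ ^ 2 ≤ w z + ε * ‖z - a‖ ^ 2) : False := by
  obtain ⟨r, hr, hrO⟩ := Metric.nhds_basis_closedBall.mem_iff.1 (hO.mem_nhds hz)
  -- the last term makes `z` a strict maximum on the zero locus
  set Q : Cn n → ℝ := fun x => w x + (ε * ‖x - a‖ ^ 2 - ε / 2 * ‖x - z‖ ^ 2) with hQ
  have hQusc : UpperSemicontinuousOn Q (Metric.closedBall z r) :=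
    (hw.1.mono hrO).add (Continuous.continuousOn (by fun_prop)).upperSemicontinuousOn
  have hHc : ContinuousOn H (Metric.closedBall z r) := hH.continuousOn.mono hrO
  have hN : ∃ N : ℝ, 0 ≤ N ∧ ∀ x ∈ Metric.sphere z r, Q x - N * ‖H x‖ ^ 2 < Q z := by
    refine (isCompact_sphere z r).induction_on
      (p := fun s => ∃ N : ℝ, 0 ≤ N ∧ ∀ x ∈ s, Q x - N * ‖H x‖ ^ 2 < Q z)
      ⟨0, le_rfl, by simp⟩ ?_ ?_ ?_
    · rintro s t hst ⟨N, hN, h⟩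
      exact ⟨N, hN, fun x hx => h x (hst hx)⟩
    · rintro s t ⟨N, hN, h⟩ ⟨N', hN', h'⟩
      refine ⟨max N N', hN.trans (le_max_left _ _), ?_⟩
      rintro x (hx | hx)
      · refine lt_of_le_of_lt ?_ (h x hx)
        gcongr
        exact le_max_left _ _
      · refine lt_of_le_of_lt ?_ (h' x hx)
        gcongr
        exact le_max_right _ _
    · intro x hx
      have hxb : x ∈ Metric.closedBall z r := Metric.sphere_subset_closedBall hx
      have hle : 𝓝[Metric.sphere z r] x ≤ 𝓝[Metric.closedBall z r] x :=
        nhdsWithin_mono _ Metric.sphere_subset_closedBall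
      by_cases hHx : H x = 0
      · have hlt : Q x < Q z := by
          have h1 := hmax x (hrO hxb) hHx
          have h2 : ‖x - z‖ = r := by simpa [dist_eq_norm] using hx
          have h3 : 0 < ε / 2 * r ^ 2 := by positivity
          simp only [hQ, h2, sub_self, norm_zero]
          linarith
        refine ⟨_, (hle (hQusc x hxb _ hlt) : ∀ᶠ y in 𝓝[Metric.sphere z r] x, Q y < Q z),
          0, le_rfl, fun y hy => ?_⟩
        simpa using hy
      · have hpos : 0 < ‖H x‖ := norm_pos_iff.2 hHx
        have h1 : ∀ᶠ y in 𝓝[Metric.sphere z r] x, Q y < Q x + 1 :=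
          hle (hQusc x hxb _ (lt_add_one _))
        have h2 : ∀ᶠ y in 𝓝[Metric.sphere z r] x, ‖H x‖ / 2 < ‖H y‖ :=
          hle ((hHc x hxb).norm.eventually (lt_mem_nhds (half_lt_self hpos)))
        refine ⟨_, h1.and h2, (|Q x + 1 - Q z|) / (‖H x‖ / 2) ^ 2, by positivity, ?_⟩
        rintro y ⟨hy1, hy2⟩
        have h3 : |Q x + 1 - Q z| ≤ |Q x + 1 - Q z| / (‖H x‖ / 2) ^ 2 * ‖H y‖ ^ 2 := by
          rw [div_mul_eq_mul_div, le_div_iff₀ (by positivity)]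
          gcongr
        have h4 := le_abs_self (Q x + 1 - Q z)
        linarith
  obtain ⟨N, hN0, hN⟩ := hN
  have hPusc : UpperSemicontinuousOn (fun x => Q x + -(N * ‖H x‖ ^ 2)) (Metric.closedBall z r) :=
    hQusc.add ((continuousOn_const.mul (hHc.norm.pow 2)).neg).upperSemicontinuousOn
  obtain ⟨y, hyb, hymax⟩ := hPusc.exists_isMaxOn
    ⟨z, Metric.mem_closedBall_self hr.le⟩ (isCompact_closedBall z r)
  have hymax' : ∀ x ∈ Metric.closedBall z r, Q x - N * ‖H x‖ ^ 2 ≤ Q y - N * ‖H y‖ ^ 2 := by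
    intro x hx
    have := hymax hx
    simpa [sub_eq_add_neg] using this
  have hyball : y ∈ Metric.ball z r := by
    rcases (Metric.mem_closedBall.1 hyb).lt_or_eq with h | h
    · exact h
    · have h1 := hN y h
      have h2 := hymax' z (Metric.mem_closedBall_self hr.le)
      simp only [hHz, norm_zero] at h2
      nlinarith
  have hyO : y ∈ O := hrO hyb
  obtain ⟨v, hv, hHv⟩ := hker y hyO
  have hv0 : 0 < ‖v‖ := norm_pos_iff.2 hv
  -- `κ` is chosen so that `N κ² ≤ ε / 4`
  obtain ⟨κ, hκ, hNκ⟩ : ∃ κ : ℝ, 0 < κ ∧ N * κ ^ 2 ≤ ε / 4 := by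
    refine ⟨√(ε / 4 / (N + 1)), by positivity, ?_⟩
    rw [Real.sq_sqrt (by positivity), mul_div_assoc', div_le_iff₀ (by positivity)]
    nlinarith
  have hlo : ∀ᶠ x in 𝓝 y, ‖H x - H y - fderiv ℂ H y (x - y)‖ ≤ κ * ‖x - y‖ :=
    (hH.differentiableAt (hO.mem_nhds hyO)).hasFDerivAt.isLittleO.def hκ
  obtain ⟨σ, hσ, hball⟩ := Metric.nhds_basis_closedBall.mem_iff.1
    (hlo.and (Metric.isOpen_ball.mem_nhds hyball))
  set W : Cn n := ((σ / ‖v‖ : ℝ) : ℂ) • v with hW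
  have hWn : ‖W‖ = σ := by
    rw [hW, norm_smul, Complex.norm_real, Real.norm_of_nonneg (by positivity),
      div_mul_cancel₀ _ hv0.ne']
  have hWk : ∀ t : ℂ, fderiv ℂ H y (t • W) = 0 := fun t => by simp [hW, hHv]
  have hmem : ∀ t : ℂ, ‖t‖ ≤ 1 → y + t • W ∈ Metric.closedBall y σ := by
    intro t ht
    simp only [Metric.mem_closedBall, dist_eq_norm, add_sub_cancel_left, norm_smul, hWn]
    nlinarith
  obtain ⟨c, hc⟩ : ∃ c : ℝ, c = w y - ε / 4 * σ ^ 2 := ⟨_, rfl⟩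
  set g : ℂ → ℂ := fun t => (c : ℂ)
      + (-(2 * ε) * inner ℂ (y - a) (t • W) + ε * inner ℂ (y - z) (t • W)
        + 2 * N * inner ℂ (H y) (H (y + t • W) - H y)) with hg
  have hgd : DifferentiableOn ℂ g (Metric.closedBall 0 1) := by
    intro t ht
    have ht1 : ‖t‖ ≤ 1 := by simpa using ht
    have htO : y + t • W ∈ O := hrO (Metric.ball_subset_closedBall (hball (hmem t ht1)).2)
    have h1 : DifferentiableAt ℂ (fun t : ℂ => H (y + t • W)) t :=
      (hasDerivAt_comp_line (hH.differentiableAt (hO.mem_nhds htO))).differentiableAt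
    have h2 : ∀ b : Cn n, DifferentiableAt ℂ (fun t : ℂ => inner ℂ b (t • W)) t := fun b =>
      (innerSL ℂ b).differentiableAt.comp t (by fun_prop)
    have h3 : DifferentiableAt ℂ (fun t : ℂ => inner ℂ (H y) (H (y + t • W) - H y)) t :=
      (innerSL ℂ (H y)).differentiableAt.comp t (h1.sub_const _)
    exact ((((h2 _).const_mul _).add ((h2 _).const_mul _)).add
      (h3.const_mul _)).const_add _ |>.differentiableWithinAt
  have hgle : ∀ t : ℂ, ‖t‖ = 1 → w (y + t • W) ≤ (g t).re := by
    intro t ht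
    obtain ⟨hl, hb⟩ := hball (hmem t ht.le)
    have h1 := hymax' _ (Metric.ball_subset_closedBall hb)
    have hxn : ‖t • W‖ = σ := by rw [norm_smul, ht, one_mul, hWn]
    rw [add_sub_cancel_left, hWk, sub_zero, hxn] at hl
    have e1 := @norm_add_sq ℂ (Cn n) _ _ _ (y - a) (t • W)
    have e2 := @norm_add_sq ℂ (Cn n) _ _ _ (y - z) (t • W)
    have e3 := @norm_add_sq ℂ (Cn n) _ _ _ (H y) (H (y + t • W) - H y)
    rw [add_sub_cancel] at e3
    have i1 : y - a + t • W = y + t • W - a := by abel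
    have i2 : y - z + t • W = y + t • W - z := by abel
    rw [i1, hxn] at e1
    rw [i2, hxn] at e2
    have hq : N * ‖H (y + t • W) - H y‖ ^ 2 ≤ ε / 4 * σ ^ 2 := by
      calc N * ‖H (y + t • W) - H y‖ ^ 2 ≤ N * (κ * σ) ^ 2 := by gcongr
        _ = N * κ ^ 2 * σ ^ 2 := by ring
        _ ≤ ε / 4 * σ ^ 2 := by gcongr
    simp only [hQ, e1, e2, e3] at h1
    have hgre : (g t).re = c
        + (-(2 * ε) * (inner ℂ (y - a) (t • W)).re + ε * (inner ℂ (y - z) (t • W)).re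
          + 2 * N * (inner ℂ (H y) (H (y + t • W) - H y)).re) := by
      simp [hg]
    rw [hgre]
    simp only [RCLike.re_to_complex] at h1
    linarith
  have hfin := hw.le_re_of_forall_le_re
    (fun t ht => hrO (Metric.ball_subset_closedBall (hball (hmem t ht)).2)) hgd hgle
  have hg0 : (g 0).re = c := by simp [hg]
  rw [hg0] at hfin
  have : 0 < ε / 4 * σ ^ 2 := by positivity
  linarith

lemma IsPlurisubharmonicOn.add_log_norm {u : Cn n → ℝ} {S B : Set (Cn n)}
    (hu : IsPlurisubharmonicOn u S) {J : Cn n → ℂ} (hB : IsOpen B) (hJ : DifferentiableOn ℂ J B)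
    (hSB : S ⊆ B) (hJ0 : ∀ x ∈ S, J x ≠ 0) (τ : ℝ) :
    IsPlurisubharmonicOn (fun x => u x + τ * Real.log ‖J x‖) S := by
  constructor
  · refine hu.1.add (ContinuousOn.upperSemicontinuousOn ?_)
    exact continuousOn_const.mul ((hJ.continuousOn.mono hSB).norm.log
      fun x hx => norm_ne_zero_iff.2 (hJ0 x hx))
  · intro z w hd
    obtain ⟨hi, hm⟩ := hu.2 z w hd
    have hUo : IsOpen {t : ℂ | z + t • w ∈ B} :=
      hB.preimage (by fun_prop : Continuous fun t : ℂ => z + t • w)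
    have hdiff : DifferentiableOn ℂ (fun t : ℂ => J (z + t • w)) {t : ℂ | z + t • w ∈ B} :=
      fun t ht => (hasDerivAt_comp_line
        (hJ.differentiableAt (hB.mem_nhds ht))).differentiableAt.differentiableWithinAt
    have hsub : Metric.closedBall (0 : ℂ) 1 ⊆ {t : ℂ | z + t • w ∈ B} :=
      fun t ht => hSB (hd t (by simpa using ht))
    have hne : ∀ t ∈ Metric.closedBall (0 : ℂ) 1, J (z + t • w) ≠ 0 :=
      fun t ht => hJ0 _ (hd t (by simpa using ht))
    have havg : Real.circleAverage (fun t : ℂ => Real.log ‖J (z + t • w)‖) 0 1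
        = Real.log ‖J z‖ := by
      have h := AnalyticOnNhd.circleAverage_log_norm_of_ne_zero (R := 1) (c := 0)
        (g := fun t : ℂ => J (z + t • w))
        (by simpa using (hdiff.analyticOnNhd hUo).mono hsub) (by simpa using hne)
      simpa using h
    have hli : CircleIntegrable (fun t : ℂ => Real.log ‖J (z + t • w)‖) 0 1 := by
      refine ContinuousOn.circleIntegrable zero_le_one ?_
      exact (((hdiff.continuousOn.mono hsub).norm.log fun t ht =>
        norm_ne_zero_iff.2 (hne t ht))).mono Metric.sphere_subset_closedBall
    have hli' : CircleIntegrable (fun t : ℂ => τ * Real.log ‖J (z + t • w)‖) 0 1 :=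
      hli.const_smul (a := τ)
    refine ⟨hi.add hli', ?_⟩
    have h1 := Real.circleAverage_fun_add hi hli'
    have h2 : Real.circleAverage (fun t : ℂ => τ * Real.log ‖J (z + t • w)‖) 0 1
        = τ * Real.log ‖J z‖ := by
      rw [← havg]; exact Real.circleAverage_fun_smul (a := τ)
    rw [h1, h2]
    linarith

/-- A maximum principle on a compact set `K` with boundary part `K₀` and singular part `{J = 0}`:
away from them `K` is required to contain, near each of its points, the zero locus of a holomorphic
map with nowhere injective differential. Adding a small multiple of `log |J|` to the function keeps
the maximum away from the singular part. -/
lemma IsPlurisubharmonicOn.le_of_forall_mem_boundary_le {K K₀ O B : Set (Cn n)}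
    (hK : IsCompact K) {u : Cn n → ℝ} (hO : IsOpen O) (hKO : K ⊆ O)
    (hu : IsPlurisubharmonicOn u O) {J : Cn n → ℂ} (hB : IsOpen B) (hKB : K ⊆ B)
    (hJ : DifferentiableOn ℂ J B)
    (hloc : ∀ z ∈ K \ K₀, J z ≠ 0 → ∃ U : Set (Cn n), IsOpen U ∧ z ∈ U ∧ ∃ H : Cn n → Cn n,
      DifferentiableOn ℂ H U ∧ (∀ x ∈ U, ∃ v ≠ 0, fderiv ℂ H x v = 0) ∧ H z = 0 ∧
      ∀ x ∈ U, H x = 0 → x ∈ K)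
    {M : ℝ} (hM : ∀ x ∈ K ∩ K₀, u x ≤ M) {z : Cn n} (hz : z ∈ K) (hJz : J z ≠ 0) :
    u z ≤ M := by
  by_contra! hlt
  obtain ⟨d, hd⟩ : ∃ d, d = u z - M := ⟨_, rfl⟩
  have hd0 : 0 < d := by linarith
  have hJK : ContinuousOn J K := hJ.continuousOn.mono hKB
  obtain ⟨L, hL⟩ := hK.exists_bound_of_continuousOn hJK
  obtain ⟨D, hD⟩ := hK.exists_bound_of_continuousOn (f := fun x => x - z) (by fun_prop)
  have huK : UpperSemicontinuousOn u K := hu.1.mono hKO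
  obtain ⟨y₀, hy₀, hy₀max⟩ := huK.exists_isMaxOn ⟨z, hz⟩ hK
  have hJz' : 0 < ‖J z‖ := norm_pos_iff.2 hJz
  have hD0 : 0 ≤ D := (norm_nonneg _).trans (hD z hz)
  obtain ⟨ε, hε, hεD⟩ : ∃ ε > 0, ε * D ^ 2 ≤ d / 3 := by
    refine ⟨d / 3 / (D ^ 2 + 1), by positivity, ?_⟩
    rw [div_mul_eq_mul_div, div_le_iff₀ (by positivity)]
    nlinarith
  have hlogL : Real.log ‖J z‖ ≤ Real.log L := Real.log_le_log hJz' (hL z hz)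
  obtain ⟨τ, hτ, hτL⟩ : ∃ τ > 0, τ * (Real.log L - Real.log ‖J z‖) < d / 3 := by
    refine ⟨d / 3 / (Real.log L - Real.log ‖J z‖ + 1), by
      have := sub_nonneg.2 hlogL; positivity, ?_⟩
    have := sub_nonneg.2 hlogL
    rw [div_mul_eq_mul_div, div_lt_iff₀ (by positivity)]
    nlinarith
  set Φ : Cn n → ℝ := fun x => (u x + τ * Real.log ‖J x‖) + ε * ‖x - z‖ ^ 2 with hΦ
  have hΦz : Φ z = u z + τ * Real.log ‖J z‖ := by simp [hΦ]
  have hεK : ∀ x ∈ K, ε * ‖x - z‖ ^ 2 ≤ d / 3 := fun x hx =>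
    le_trans (by gcongr; exact hD x hx) hεD
  -- points with `‖J‖ < c` do not compete for the maximum
  set c : ℝ := Real.exp ((Φ z - u y₀ - d) / τ) with hc
  have hτc : τ * Real.log c = Φ z - u y₀ - d := by
    rw [hc, Real.log_exp, mul_div_cancel₀ _ hτ.ne']
  have hsmall : ∀ x ∈ K, J x ≠ 0 → ‖J x‖ < c → Φ x < Φ z := by
    intro x hx hJx hxc
    have h1 : τ * Real.log ‖J x‖ < τ * Real.log c :=
      mul_lt_mul_of_pos_left (Real.log_lt_log (norm_pos_iff.2 hJx) hxc) hτ
    have h2 := hεK x hx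
    have h3 : u x ≤ u y₀ := hy₀max hx
    simp only [hΦ] at hτc ⊢
    linarith
  have hKc : IsCompact (K ∩ {x | c ≤ ‖J x‖}) := by
    have : IsClosed (K ∩ {x | c ≤ ‖J x‖}) :=
      hJK.norm.preimage_isClosed_of_isClosed hK.isClosed isClosed_Ici
    exact hK.of_isClosed_subset this inter_subset_left
  have hzc : z ∈ K ∩ {x | c ≤ ‖J x‖} := by
    refine ⟨hz, ?_⟩
    by_contra h
    exact lt_irrefl _ (hsmall z hz hJz (not_le.1 h))
  have hJne : ∀ x ∈ K ∩ {x | c ≤ ‖J x‖}, J x ≠ 0 := fun x hx =>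
    norm_pos_iff.1 ((Real.exp_pos _).trans_le hx.2)
  have hΦusc : UpperSemicontinuousOn Φ (K ∩ {x | c ≤ ‖J x‖}) := by
    refine ((huK.mono inter_subset_left).add (ContinuousOn.upperSemicontinuousOn ?_)).add
      (Continuous.continuousOn (by fun_prop)).upperSemicontinuousOn
    exact continuousOn_const.mul ((hJK.mono inter_subset_left).norm.log
      fun x hx => norm_ne_zero_iff.2 (hJne x hx))
  obtain ⟨y, hy, hymax⟩ := hΦusc.exists_isMaxOn ⟨z, hzc⟩ hKc
  have hyz : Φ z ≤ Φ y := hymax hzc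
  have hyall : ∀ x ∈ K, J x ≠ 0 → Φ x ≤ Φ y := by
    intro x hx hJx
    by_cases h : c ≤ ‖J x‖
    · exact hymax ⟨hx, h⟩
    · exact (hsmall x hx hJx (not_le.1 h)).le.trans hyz
  have hJy := hJne y hy
  have hyK₀ : y ∉ K₀ := by
    intro h
    have h1 := hM y ⟨hy.1, h⟩
    have h2 : τ * Real.log ‖J y‖ ≤ τ * Real.log L :=
      mul_le_mul_of_nonneg_left (Real.log_le_log (norm_pos_iff.2 hJy) (hL y hy.1)) hτ.le
    have h3 := hεK y hy.1
    rw [hΦz] at hyz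
    simp only [hΦ] at hyz
    linarith
  obtain ⟨U, hU, hyU, H, hH, hker, hHy, hHK⟩ := hloc y ⟨hy.1, hyK₀⟩ hJy
  have hBJ : IsOpen (B ∩ {x | J x ≠ 0}) :=
    hJ.continuousOn.isOpen_inter_preimage hB isOpen_compl_singleton
  have hw := (hu.mono (S := U ∩ O ∩ (B ∩ {x | J x ≠ 0})) fun x hx => hx.1.2).add_log_norm
    hB hJ (fun x hx => hx.2.1) (fun x hx => hx.2.2) τ
  exact hw.not_isMax_on_zeroLocus ((hU.inter hO).inter hBJ) (hH.mono fun x hx => hx.1.1)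
    (fun x hx => hker x hx.1.1) ⟨⟨hyU, hKO hy.1⟩, hKB hy.1, hJy⟩ hHy hε (a := z)
    fun x hx hHx => hyall x (hHK x hx.1.1 hHx) hx.2.2

end Plurisubharmonic

/-! ### Analytic hulls and Cramer vector fields -/

section Hull

variable {n : ℕ}

/-- The ideal of the holomorphic functions on `B` that vanish on `S`. -/
def vanishingIdeal (B S : Set (Cn n)) : Set (Cn n → ℂ) :=
  {h | DifferentiableOn ℂ h B ∧ ∀ z ∈ S, h z = 0}

/-- The smallest subset of `B` containing `S` that is cut out by holomorphic functions on `B`. -/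
def analyticHull (B S : Set (Cn n)) : Set (Cn n) :=
  {z ∈ B | ∀ h ∈ vanishingIdeal B S, h z = 0}

lemma fderiv_coord_apply {k : ℕ} {f : Cn n → Cn k} {z : Cn n} (hf : DifferentiableAt ℂ f z)
    (i : Fin k) (v : Cn n) : fderiv ℂ (fun x => f x i) z v = fderiv ℂ f z v i := by
  have h3 : HasFDerivAt (fun x => f x i)
      ((EuclideanSpace.proj i : Cn k →L[ℂ] ℂ) ∘L fderiv ℂ f z) z :=
    (EuclideanSpace.proj i : Cn k →L[ℂ] ℂ).hasFDerivAt.comp z hf.hasFDerivAt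
  rw [h3.fderiv]; rfl

/-- A maximal number of functions in the ideal of `S` with independent differentials at some point
of `S`: their differentials span those of the whole ideal wherever they are independent. -/
lemma exists_maximal_rank {B S : Set (Cn n)} (hB : IsOpen B) (hSB : S ⊆ B) (hS : S.Nonempty) :
    ∃ (m : ℕ) (F : Cn n → Cn m), DifferentiableOn ℂ F B ∧ (∀ z ∈ S, F z = 0) ∧
      (∃ q ∈ S, Function.Surjective (fderiv ℂ F q)) ∧
      ∀ z ∈ S, Function.Surjective (fderiv ℂ F z) → ∀ h ∈ vanishingIdeal B S, ∀ v,
        fderiv ℂ F z v = 0 → fderiv ℂ h z v = 0 := by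
  set P : ℕ → Prop := fun m => ∃ F : Cn n → Cn m, DifferentiableOn ℂ F B ∧ (∀ z ∈ S, F z = 0) ∧
    ∃ q ∈ S, Function.Surjective (fderiv ℂ F q) with hP
  have hbound : ¬ P (n + 1) := by
    rintro ⟨F, -, -, q, -, hq⟩
    have := LinearMap.finrank_le_finrank_of_surjective (f := (fderiv ℂ F q).toLinearMap) hq
    simp at this
  obtain ⟨m, ⟨F, hF, hFS, hq⟩, hm'⟩ : ∃ m, P m ∧ ¬ P (m + 1) := by
    by_contra! hcon
    have hall : ∀ m, P m := by
      intro m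
      induction m with
      | zero =>
        obtain ⟨q, hq⟩ := hS
        exact ⟨fun _ => 0, differentiableOn_const _, fun _ _ => rfl, q, hq,
          fun y => ⟨0, Subsingleton.elim _ _⟩⟩
      | succ m ih => exact hcon m ih
    exact hbound (hall _)
  refine ⟨m, F, hF, hFS, hq, ?_⟩
  intro z hz hsurj h hh v hv
  by_contra hne
  refine hm' ⟨fun x => WithLp.toLp 2 (Fin.cons (h x) (F x)), ?_, ?_, z, hz, ?_⟩
  · refine differentiableOn_euclidean.2 fun i => ?_
    refine Fin.cases ?_ (fun j => ?_) i
    · simpa using hh.1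
    · simpa using differentiableOn_euclidean.1 hF j
  · intro x hx
    ext i
    refine Fin.cases ?_ (fun j => ?_) i
    · simpa using hh.2 x hx
    · simp [hFS x hx]
  · have hzB := hB.mem_nhds (hSB hz)
    have hd : DifferentiableAt ℂ
        (fun x => (WithLp.toLp 2 (Fin.cons (h x) (F x)) : Cn (m + 1))) z := by
      refine differentiableAt_euclidean.2 fun i => ?_
      refine Fin.cases ?_ (fun j => ?_) i
      · simpa using hh.1.differentiableAt hzB
      · simpa using (differentiableOn_euclidean.1 hF j).differentiableAt hzB
    intro y
    obtain ⟨x₀, hx₀⟩ := hsurj (WithLp.toLp 2 fun j => y j.succ)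
    refine ⟨x₀ + ((y 0 - fderiv ℂ h z x₀) / fderiv ℂ h z v) • v, ?_⟩
    ext i
    rw [← fderiv_coord_apply hd]
    refine Fin.cases ?_ (fun j => ?_) i
    · simp [hne]
    · have h1 := fderiv_coord_apply (hF.differentiableAt hzB) j
      simp only [Fin.cons_succ]
      rw [h1, map_add, map_smul, hv, smul_zero, add_zero, hx₀]

/-- Cramer's rule: `J` is the determinant of `dΦ`, and `ξ`, its adjugate applied to `e`, is a
holomorphic substitute for `dΦ⁻¹ e` that extends across the zeros of `J`. -/
lemma exists_cramer {B : Set (Cn n)} (hB : IsOpen B) {Φ : Cn n → Cn n}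
    (hΦ : DifferentiableOn ℂ Φ B) (e : Cn n) :
    ∃ (J : Cn n → ℂ) (ξ : Cn n → Cn n), DifferentiableOn ℂ J B ∧ DifferentiableOn ℂ ξ B ∧
      (∀ z, fderiv ℂ Φ z (ξ z) = J z • e) ∧
      (∀ z, J z ≠ 0 → Function.Surjective (fderiv ℂ Φ z)) ∧
      ∀ z, fderiv ℂ Φ z = ContinuousLinearMap.id ℂ _ → J z = 1 := by
  set A : Cn n → Matrix (Fin n) (Fin n) ℂ := fun z =>
    Matrix.of fun i j => fderiv ℂ Φ z (EuclideanSpace.single j 1) i with hA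
  have hAd : ∀ i j, DifferentiableOn ℂ (fun z => A z i j) B := fun i j =>
    differentiableOn_euclidean.1 (differentiableOn_fderiv_apply hB hΦ _) i
  have hdet : ∀ C : Cn n → Matrix (Fin n) (Fin n) ℂ,
      (∀ i j, DifferentiableOn ℂ (fun z => C z i j) B) →
      DifferentiableOn ℂ (fun z => (C z).det) B := by
    intro C hC
    simp only [Matrix.det_apply']
    refine DifferentiableOn.fun_sum fun σ _ => DifferentiableOn.const_mul (fun z hz => ?_) _
    exact (HasFDerivWithinAt.finsetProd fun i _ =>
      (hC _ _ z hz).hasFDerivWithinAt).differentiableWithinAt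
  have hmul : ∀ z v, fderiv ℂ Φ z v = WithLp.toLp 2 ((A z).mulVec v) := by
    intro z v
    conv_lhs => rw [← (EuclideanSpace.basisFun (Fin n) ℂ).sum_repr v]
    ext i
    simp [hA, Matrix.mulVec, dotProduct, mul_comm]
  have hcr : ∀ z (y : Cn n), fderiv ℂ Φ z (WithLp.toLp 2 ((A z).adjugate.mulVec y))
      = (A z).det • y := by
    intro z y
    rw [hmul]
    ext i
    simp [Matrix.mulVec_mulVec, Matrix.mul_adjugate, Matrix.smul_mulVec]
  refine ⟨fun z => (A z).det, fun z => WithLp.toLp 2 ((A z).adjugate.mulVec e), hdet A hAd, ?_,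
    fun z => hcr z e, ?_, ?_⟩
  · refine differentiableOn_euclidean.2 fun i => ?_
    simp only [Matrix.mulVec, dotProduct]
    refine DifferentiableOn.fun_sum fun j _ => DifferentiableOn.mul_const ?_ _
    simp only [Matrix.adjugate_apply]
    refine hdet _ fun k l => ?_
    by_cases hk : k = j
    · subst hk; simp
    · simpa [Matrix.updateRow_ne hk] using hAd k l
  · intro z hz y
    refine ⟨(A z).det⁻¹ • WithLp.toLp 2 ((A z).adjugate.mulVec y), ?_⟩
    rw [map_smul, hcr, smul_smul, inv_mul_cancel₀ hz, one_smul]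
  · intro z hz
    have : A z = 1 := by
      ext i j
      simp [hA, hz, Matrix.one_apply]
    simp [this]

end Hull

/-! ### Holomorphic curves in an analytic hull -/

section Leaves

variable {n : ℕ}

/-- A set of holomorphic functions that is stable under a nowhere vanishing multiple of the
derivative along the curve `γ`, and whose members all vanish at `γ 0`, vanishes along `γ`: the
orders of vanishing at `0` are unbounded. -/
lemma comp_eq_zero_of_stable {B : Set (Cn n)} {I : Set (Cn n → ℂ)}
    (hI : ∀ h ∈ I, DifferentiableOn ℂ h B) {r : ℝ} (hr : 0 < r) {γ : ℂ → Cn n}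
    (hγB : ∀ s ∈ Metric.ball (0 : ℂ) r, γ s ∈ B)
    (hγ : DifferentiableOn ℂ γ (Metric.ball 0 r)) {k : ℂ → ℂ}
    (hk : DifferentiableOn ℂ k (Metric.ball 0 r))
    (hderiv : ∀ h ∈ I, ∃ g ∈ I, ∀ s ∈ Metric.ball (0 : ℂ) r,
      deriv (fun s => h (γ s)) s = k s * g (γ s))
    (h0 : ∀ h ∈ I, h (γ 0) = 0) {h : Cn n → ℂ} (hh : h ∈ I) {s : ℂ}
    (hs : s ∈ Metric.ball (0 : ℂ) r) : h (γ s) = 0 := by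
  have h0m : (0 : ℂ) ∈ Metric.ball (0 : ℂ) r := Metric.mem_ball_self hr
  have hball := (Metric.isOpen_ball (x := (0 : ℂ)) (ε := r))
  have han : ∀ h ∈ I, AnalyticOnNhd ℂ (fun s => h (γ s)) (Metric.ball 0 r) := fun h hh =>
    ((hI h hh).comp hγ hγB).analyticOnNhd hball
  have hka := hk.analyticOnNhd hball
  have hord : ∀ m : ℕ, ∀ h ∈ I, (m : ℕ∞) ≤ analyticOrderAt (fun s => h (γ s)) 0 := by
    intro m
    induction m with
    | zero => intro h _; simp
    | succ m ih =>
      intro h hh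
      obtain ⟨g, hg, hgd⟩ := hderiv h hh
      have h1 := (han h hh 0 h0m).analyticOrderAt_deriv_add_one
      simp only [h0 h hh, sub_zero] at h1
      have h2 : deriv (fun s => h (γ s)) =ᶠ[𝓝 0] k * fun s => g (γ s) := by
        filter_upwards [hball.mem_nhds h0m] with s hs using hgd s hs
      rw [← h1, analyticOrderAt_congr h2, analyticOrderAt_mul (hka 0 h0m) (han g hg 0 h0m)]
      push_cast
      gcongr
      exact (ih g hg).trans le_add_self
  have htop : analyticOrderAt (fun s => h (γ s)) 0 = ⊤ :=
    ENat.eq_top_iff_forall_ge.2 fun m => hord m h hh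
  have hev := analyticOrderAt_eq_top.1 htop
  exact (han h hh).eqOn_zero_of_preconnected_of_eventuallyEq_zero
    (convex_ball (0 : ℂ) r).isPreconnected h0m hev hs

/-- If all differentials of the ideal of `S` have a common kernel vector at the points of `S`, then
the hull of `S` is foliated by holomorphic curves off the zero set of some holomorphic `J` that does
not vanish identically on `S`. The foliation is that of a vector field `ξ` which preserves the
ideal. -/
lemma exists_foliation_analyticHull {B S : Set (Cn n)} (hB : IsOpen B) (hSB : S ⊆ B)
    (hSne : S.Nonempty)
    (hS : ∀ q ∈ S, ∃ v ≠ 0, ∀ h ∈ vanishingIdeal B S, fderiv ℂ h q v = 0) :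
    ∃ J : Cn n → ℂ, DifferentiableOn ℂ J B ∧ (∃ q ∈ S, J q ≠ 0) ∧
      ∀ z ∈ analyticHull B S, J z ≠ 0 → ∃ U : Set (Cn n), IsOpen U ∧ z ∈ U ∧
        ∃ H : Cn n → Cn n, DifferentiableOn ℂ H U ∧ (∀ x ∈ U, ∃ v ≠ 0, fderiv ℂ H x v = 0) ∧
          H z = 0 ∧ ∀ x ∈ U, H x = 0 → x ∈ analyticHull B S ∧ J x ≠ 0 := by
  obtain ⟨m, F, hF, hFS, ⟨q, hqS, hqsurj⟩, hmax⟩ := exists_maximal_rank hB hSB hSne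
  obtain ⟨e, he, hIe⟩ := hS q hqS
  have hqB := hB.mem_nhds (hSB hqS)
  obtain ⟨A, hA⟩ : ∃ A, A = fderiv ℂ F q := ⟨_, rfl⟩
  have hAe : A e = 0 := by
    ext i
    rw [hA, ← fderiv_coord_apply (hF.differentiableAt hqB)]
    exact hIe _ ⟨differentiableOn_euclidean.1 hF i, fun z hz => by simp [hFS z hz]⟩
  obtain ⟨R', hR'⟩ := A.toLinearMap.exists_rightInverse_of_surjective
    (LinearMap.range_eq_top.2 (hA ▸ hqsurj))
  set R : Cn m →L[ℂ] Cn n := LinearMap.toContinuousLinearMap R' with hRdef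
  have hAR : ∀ y, A (R y) = y := fun y => LinearMap.congr_fun hR' y
  -- a coordinate system at `q` whose components transversal to `e` belong to the ideal of `S`
  set Φ : Cn n → Cn n := fun z => R (F z) + (ContinuousLinearMap.id ℂ (Cn n) - R ∘L A) z with hΦdef
  have hΦ : DifferentiableOn ℂ Φ B :=
    (R.differentiable.comp_differentiableOn hF).add
      (ContinuousLinearMap.differentiable _).differentiableOn
  have hΦ' : ∀ z ∈ B, fderiv ℂ Φ z
      = R ∘L fderiv ℂ F z + (ContinuousLinearMap.id ℂ (Cn n) - R ∘L A) := fun z hz =>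
    ((R.hasFDerivAt.comp z (hF.differentiableAt (hB.mem_nhds hz)).hasFDerivAt).add
      (ContinuousLinearMap.hasFDerivAt _)).fderiv
  have hAΦ : ∀ z ∈ B, ∀ v, A (fderiv ℂ Φ z v) = fderiv ℂ F z v := by
    intro z hz v
    simp [hΦ' z hz, hAR]
  obtain ⟨J, ξ, hJ, hξ, hJξ, hJsurj, hJone⟩ := exists_cramer hB hΦ e
  have hJq : J q = 1 := hJone q (by rw [hΦ' q (hSB hqS), ← hA]; ext; simp)
  -- the derivation `J ∂_ξ` preserves the ideal
  have hT : ∀ h ∈ vanishingIdeal B S,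
      (fun z => J z * fderiv ℂ h z (ξ z)) ∈ vanishingIdeal B S := by
    intro h hh
    refine ⟨hJ.mul ((differentiableOn_fderiv hB hh.1).clm_apply hξ), fun z hz => ?_⟩
    change J z * fderiv ℂ h z (ξ z) = 0
    by_cases hJz : J z = 0
    · simp [hJz]
    · have hzB := hSB hz
      have hsurj : Function.Surjective (fderiv ℂ F z) := by
        intro y
        obtain ⟨x, hx⟩ := hJsurj z hJz (R y)
        exact ⟨x, by rw [← hAΦ z hzB, hx, hAR]⟩
      rw [hmax z hz hsurj h hh (ξ z) (by rw [← hAΦ z hzB, hJξ, map_smul, hAe, smul_zero]),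
        mul_zero]
  refine ⟨J, hJ, ⟨q, hqS, by simp [hJq]⟩, fun z hz hJz => ?_⟩
  have hzB : z ∈ B := hz.1
  set D : Set (Cn n) := B ∩ {x | J x ≠ 0} with hD
  have hDo : IsOpen D := hJ.continuousOn.isOpen_inter_preimage hB isOpen_compl_singleton
  have hequiv : ∀ x ∈ D, ∃ L : Cn n ≃L[ℂ] Cn n, (L : Cn n →L[ℂ] Cn n) = fderiv ℂ Φ x := by
    intro x hx
    have hs := hJsurj x hx.2
    have hi : Function.Injective (fderiv ℂ Φ x) :=
      (LinearMap.injective_iff_surjective (f := (fderiv ℂ Φ x).toLinearMap)).2 hs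
    exact ⟨(LinearEquiv.ofBijective (fderiv ℂ Φ x).toLinearMap ⟨hi, hs⟩).toContinuousLinearEquiv,
      by ext; rfl⟩
  obtain ⟨L, hL⟩ := hequiv z ⟨hzB, hJz⟩
  have hstrict : HasStrictFDerivAt Φ (L : Cn n →L[ℂ] Cn n) z :=
    hL ▸ hasStrictFDerivAt_of_differentiableOn hB hΦ hzB
  set f := hstrict.toOpenPartialHomeomorph Φ with hf
  have hfΦ : ∀ x, f x = Φ x := fun x => rfl
  have hzf : z ∈ f.source := hstrict.mem_toOpenPartialHomeomorph_source
  have hto : IsOpen (f.target ∩ f.symm ⁻¹' D) := f.isOpen_inter_preimage_symm hDo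
  have hztarget : Φ z ∈ f.target ∩ f.symm ⁻¹' D := by
    refine ⟨f.map_source hzf, ?_⟩
    change f.symm (f z) ∈ D
    rw [f.left_inv hzf]
    exact ⟨hzB, hJz⟩
  obtain ⟨r, hr, hrsub⟩ : ∃ r > 0, ∀ s ∈ Metric.ball (0 : ℂ) r,
      Φ z + s • e ∈ f.target ∩ f.symm ⁻¹' D := by
    have hc : ContinuousAt (fun s : ℂ => Φ z + s • e) 0 := by fun_prop
    have hev : ∀ᶠ s in 𝓝 (0 : ℂ), Φ z + s • e ∈ f.target ∩ f.symm ⁻¹' D :=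
      hc.eventually (hto.mem_nhds (by simpa only [zero_smul, add_zero] using hztarget))
    exact Metric.eventually_nhds_iff_ball.1 hev
  set γ : ℂ → Cn n := fun s => f.symm (Φ z + s • e) with hγdef
  have hγ0 : γ 0 = z := by
    have : f.symm (f z) = z := f.left_inv hzf
    simpa [hγdef, hfΦ] using this
  have hγD : ∀ s ∈ Metric.ball (0 : ℂ) r, γ s ∈ D := fun s hs => (hrsub s hs).2
  have hγ' : ∀ s ∈ Metric.ball (0 : ℂ) r, HasDerivAt γ ((J (γ s))⁻¹ • ξ (γ s)) s := by
    intro s hs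
    obtain ⟨L', hL'⟩ := hequiv _ (hγD s hs)
    have h1 : HasFDerivAt f (L' : Cn n →L[ℂ] Cn n) (f.symm (Φ z + s • e)) := by
      rw [hL']
      exact (hΦ.differentiableAt (hB.mem_nhds (hγD s hs).1)).hasFDerivAt
    have h2 := f.hasFDerivAt_symm (hrsub s hs).1 h1
    have h3 : HasDerivAt (fun s : ℂ => Φ z + s • e) e s := by
      simpa using ((hasDerivAt_id s).smul_const e).const_add (Φ z)
    have h4 := h2.comp_hasDerivAt s h3
    have h5 : (L'.symm : Cn n →L[ℂ] Cn n) e = (J (γ s))⁻¹ • ξ (γ s) := by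
      have h6 : L' ((J (γ s))⁻¹ • ξ (γ s)) = e := by
        have h7 : L' ((J (γ s))⁻¹ • ξ (γ s)) = fderiv ℂ Φ (γ s) ((J (γ s))⁻¹ • ξ (γ s)) := by
          rw [← hL']; rfl
        rw [h7, map_smul, hJξ, smul_smul, inv_mul_cancel₀ (hγD s hs).2, one_smul]
      rw [ContinuousLinearEquiv.coe_coe, ContinuousLinearEquiv.symm_apply_eq, h6]
    rw [h5] at h4
    exact h4
  have hγd : DifferentiableOn ℂ γ (Metric.ball 0 r) := fun s hs =>
    (hγ' s hs).differentiableAt.differentiableWithinAt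
  have hkd : DifferentiableOn ℂ (fun s => ((J (γ s)) ^ 2)⁻¹) (Metric.ball 0 r) :=
    ((hJ.comp hγd fun s hs => (hγD s hs).1).pow 2).inv fun s hs => pow_ne_zero 2 (hγD s hs).2
  have hγhull : ∀ s ∈ Metric.ball (0 : ℂ) r, γ s ∈ analyticHull B S := by
    intro s hs
    refine ⟨(hγD s hs).1, fun h hh => ?_⟩
    refine comp_eq_zero_of_stable (fun h hh => hh.1) hr (fun s hs => (hγD s hs).1) hγd hkd
      (fun h hh => ⟨_, hT h hh, fun s hs => ?_⟩) (fun h hh => ?_) hh hs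
    · have h1 := ((hh.1.differentiableAt
        (hB.mem_nhds (hγD s hs).1)).hasFDerivAt.comp_hasDerivAt s (hγ' s hs)).deriv
      have hJne := (hγD s hs).2
      change deriv (h ∘ γ) s = _
      rw [h1, map_smul, smul_eq_mul]
      field_simp
    · rw [hγ0]; exact hz.2 h hh
  -- `H` is the part of `Φ - Φ z` orthogonal to `e`
  have he' : 0 < ‖e‖ := norm_pos_iff.2 he
  set l : Cn n →L[ℂ] ℂ := ((‖e‖ : ℂ) ^ 2)⁻¹ • innerSL ℂ e with hl
  have hle : l e = 1 := by
    have : (‖e‖ : ℂ) ≠ 0 := by exact_mod_cast he'.ne'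
    simp [hl, inner_self_eq_norm_sq_to_K, this]
  set P : Cn n →L[ℂ] Cn n := ContinuousLinearMap.id ℂ _ - l.smulRight e with hP
  have hPe : P e = 0 := by simp [hP, hle]
  have hUo : IsOpen (f.source ∩ (D ∩ (fun x => ‖Φ x - Φ z‖) ⁻¹' Iio (r * ‖e‖))) :=
    f.open_source.inter (((hΦ.mono inter_subset_left).continuousOn.sub
      continuousOn_const).norm.isOpen_inter_preimage hDo isOpen_Iio)
  refine ⟨_, hUo, ⟨hzf, ⟨hzB, hJz⟩, by simpa using by positivity⟩, fun x => P (Φ x - Φ z), ?_, ?_,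
    by simp, ?_⟩
  · exact P.differentiable.comp_differentiableOn
      ((hΦ.mono fun x hx => hx.2.1.1).sub_const _)
  · rintro x ⟨-, hx, -⟩
    have h1 : HasFDerivAt (fun x => P (Φ x - Φ z)) (P ∘L fderiv ℂ Φ x) x :=
      P.hasFDerivAt.comp x ((hΦ.differentiableAt (hB.mem_nhds hx.1)).hasFDerivAt.sub_const _)
    refine ⟨ξ x, ?_, ?_⟩
    · intro h0
      have h2 := hJξ x
      rw [h0, map_zero] at h2
      exact (smul_ne_zero hx.2 he) h2.symm
    · rw [h1.fderiv, ContinuousLinearMap.comp_apply, hJξ, map_smul, hPe, smul_zero]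
  · rintro x ⟨hxf, hxD, hxr⟩ hPx
    set s : ℂ := l (Φ x - Φ z) with hs
    have h1 : Φ x - Φ z = s • e := by
      have h2 : Φ x - Φ z - s • e = 0 := hPx
      exact sub_eq_zero.1 h2
    have h3 : s ∈ Metric.ball (0 : ℂ) r := by
      have h4 : ‖Φ x - Φ z‖ < r * ‖e‖ := hxr
      rw [h1, norm_smul] at h4
      simpa using lt_of_mul_lt_mul_right h4 he'.le
    have h5 : γ s = x := by
      have h6 : f.symm (f x) = x := f.left_inv hxf
      rw [hγdef]
      simp only [← h1, add_sub_cancel]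
      exact h6
    exact ⟨h5 ▸ hγhull s h3, hxD.2⟩

/-- Near a regular point `q` of dimension one, `Z` contains a set of points at which it has a
tangent vector. -/
lemma IsRegularPointOfDim.exists_subset {Z : Set (Cn n)} {q : Cn n}
    (hq : IsRegularPointOfDim Z 1 q) {B N : Set (Cn n)} (hB : IsOpen B) (hqB : q ∈ B)
    (hN : IsOpen N) (hqN : q ∈ N) :
    ∃ S : Set (Cn n), S ⊆ Z ∩ B ∩ N ∧ S.Nonempty ∧
      ∀ x ∈ S, ∃ v ≠ 0, ∀ h ∈ vanishingIdeal B S, fderiv ℂ h x v = 0 := by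
  obtain ⟨hqZ, k, hk, W, hW, hqW, F, hF, hsurj, hZW⟩ := hq
  obtain ⟨R', hR'⟩ := (fderiv ℂ F q).toLinearMap.exists_rightInverse_of_surjective
    (LinearMap.range_eq_top.2 hsurj)
  set R : Cn k →L[ℂ] Cn n := LinearMap.toContinuousLinearMap R'
  have hFd : ContinuousOn (fderiv ℂ F) W :=
    (differentiableOn_fderiv_of_apply fun v => differentiableOn_fderiv_apply hW hF v).continuousOn
  have hcont : ContinuousOn (fun x => fderiv ℂ F x ∘L R) W := hFd.clm_comp continuousOn_const
  have hUo : IsOpen (W ∩ (fun x => fderiv ℂ F x ∘L R) ⁻¹' {T | IsUnit T}) :=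
    hcont.isOpen_inter_preimage hW Units.isOpen
  set U := W ∩ (fun x => fderiv ℂ F x ∘L R) ⁻¹' {T | IsUnit T} with hU
  have hqU : q ∈ U := by
    refine ⟨hqW, ?_⟩
    have : fderiv ℂ F q ∘L R = 1 := by
      ext1 y
      exact LinearMap.congr_fun hR' y
    simp [this]
  have hUsurj : ∀ x ∈ U, Function.Surjective (fderiv ℂ F x) := by
    rintro x ⟨-, T, hT⟩ y
    refine ⟨R ((↑T⁻¹ : Cn k →L[ℂ] Cn k) y), ?_⟩
    change (fderiv ℂ F x ∘L R) ((↑T⁻¹ : Cn k →L[ℂ] Cn k) y) = y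
    have hT' : (T : Cn k →L[ℂ] Cn k) = fderiv ℂ F x ∘L R := hT
    rw [← hT', ← mul_apply_eq_comp, Units.mul_inv]
    rfl
  have hUBN : IsOpen (U ∩ (B ∩ N)) := hUo.inter (hB.inter hN)
  refine ⟨{x | x ∈ U ∩ (B ∩ N) ∧ F x = 0}, ?_, ⟨q, ⟨hqU, hqB, hqN⟩, ?_⟩, ?_⟩
  · rintro x ⟨⟨hxU, hxB, hxN⟩, hFx⟩
    have : x ∈ Z ∩ W := hZW ▸ ⟨hxU.1, hFx⟩
    exact ⟨⟨this.1, hxB⟩, hxN⟩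
  · have : q ∈ {z ∈ W | F z = 0} := hZW ▸ ⟨hqZ, hqW⟩
    exact this.2
  · rintro x ⟨hx, hFx⟩
    have hxsurj := hUsurj x hx.1
    have hker : LinearMap.ker (fderiv ℂ F x).toLinearMap ≠ ⊥ :=
      LinearMap.ker_ne_bot_of_finrank_lt (by simp; omega)
    obtain ⟨v, hv, hv0⟩ := (Submodule.ne_bot_iff _).1 hker
    refine ⟨v, hv0, fun h hh => ?_⟩
    have hst := hasStrictFDerivAt_of_differentiableOn hW hF hx.1.1
    have hrange : (fderiv ℂ F x).toLinearMap.range = ⊤ := LinearMap.range_eq_top.2 hxsurj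
    set φ := hst.implicitFunction F (fderiv ℂ F x) hrange (F x) with hφ
    have hφ' : HasStrictFDerivAt φ (fderiv ℂ F x).toLinearMap.ker.subtypeL 0 :=
      hst.to_implicitFunction hrange
    have hφ0 : φ 0 = x := hst.implicitFunction_apply_image hrange
    have hev1 : ∀ᶠ y in 𝓝 (0 : (fderiv ℂ F x).toLinearMap.ker), F (φ y) = F x := by
      have h1 := hst.map_implicitFunction_eq hrange
      have h2 : Tendsto (fun y : (fderiv ℂ F x).toLinearMap.ker => (F x, y)) (𝓝 0)
          (𝓝 (F x, 0)) := (by fun_prop : Continuous fun y :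
            (fderiv ℂ F x).toLinearMap.ker => (F x, y)).tendsto 0
      exact h2.eventually h1
    have hev2 : ∀ᶠ y in 𝓝 (0 : (fderiv ℂ F x).toLinearMap.ker), φ y ∈ U ∩ (B ∩ N) := by
      have := hφ'.hasFDerivAt.continuousAt
      exact this.eventually (by rw [hφ0]; exact hUBN.mem_nhds hx)
    have hzero : (fun y => h (φ y)) =ᶠ[𝓝 0] fun _ => (0 : ℂ) := by
      filter_upwards [hev1, hev2] with y hy1 hy2
      exact hh.2 _ ⟨hy2, hy1.trans hFx⟩
    have hd : HasFDerivAt (fun y => h (φ y))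
        (fderiv ℂ h x ∘L (fderiv ℂ F x).toLinearMap.ker.subtypeL) 0 := by
      refine HasFDerivAt.comp (g := h) 0 ?_ hφ'.hasFDerivAt
      rw [hφ0]
      exact (hh.1.differentiableAt (hB.mem_nhds hx.2.1)).hasFDerivAt
    have h0 := (hd.congr_of_eventuallyEq hzero.symm).unique (hasFDerivAt_const (0 : ℂ) _)
    exact DFunLike.congr_fun h0 (⟨v, hv⟩ : (fderiv ℂ F x).toLinearMap.ker)

end Leaves

/-! ### The maximum principle along a curve -/

section Curve

variable {n : ℕ}

lemma isPlurisubharmonicOn_const (c : ℝ) (S : Set (Cn n)) :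
    IsPlurisubharmonicOn (fun _ => c) S :=
  ⟨continuousOn_const.upperSemicontinuousOn, fun z w _ =>
    ⟨continuousOn_const.circleIntegrable zero_le_one, by simp [Real.circleAverage_const]⟩⟩

/-- Arbitrarily near `z₀` a curve `Z` through `z₀` carries a compact piece `K` of the ball of radius
`δ` on which plurisubharmonic functions satisfy the maximum principle, its boundary being the part
on the sphere. The estimate is asserted on a dense subset `A`, off the singularities of `K`. -/
lemma IsComplexCurveThrough.exists_maximum_principle {Z : Set (Cn n)} {z₀ : Cn n}
    (hZ : IsComplexCurveThrough Z z₀) :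
    ∃ ρ > 0, ∀ δ ∈ Ioo 0 ρ, ∀ κ > 0, ∃ K A : Set (Cn n), IsCompact K ∧ A ⊆ K ∧ K ⊆ closure A ∧
      K ⊆ Z ∩ Metric.closedBall z₀ δ ∧ (∃ q ∈ A, ‖q - z₀‖ < κ) ∧
      ∀ (u : Cn n → ℝ) (O : Set (Cn n)) (M : ℝ), IsOpen O → K ⊆ O → IsPlurisubharmonicOn u O →
        (∀ x ∈ K ∩ Metric.sphere z₀ δ, u x ≤ M) → ∀ x ∈ A, u x ≤ M := by
  obtain ⟨hz₀Z, ⟨W, hW, hz₀W, m, f, hf, hZW⟩, hreg, -⟩ := hZ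
  obtain ⟨ρ, hρ, hρW⟩ := Metric.nhds_basis_ball.mem_iff.1 (hW.mem_nhds hz₀W)
  refine ⟨ρ, hρ, fun δ hδ κ hκ => ?_⟩
  have hδW : Metric.closedBall z₀ δ ⊆ W :=
    (Metric.closedBall_subset_ball hδ.2).trans hρW
  have hmin : 0 < min κ δ := lt_min hκ hδ.1
  obtain ⟨q₁, hq₁reg, hq₁⟩ := Metric.mem_closure_iff.1 hreg _ hmin
  have hq₁N : q₁ ∈ Metric.ball z₀ (min κ δ) := by rwa [Metric.mem_ball, dist_comm]
  have hNW : Metric.ball z₀ (min κ δ) ⊆ Metric.closedBall z₀ δ :=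
    (Metric.ball_subset_ball (min_le_right _ _)).trans Metric.ball_subset_closedBall
  obtain ⟨S, hSsub, hSne, hS⟩ := hq₁reg.exists_subset hW (hδW (hNW hq₁N)) Metric.isOpen_ball hq₁N
  obtain ⟨J, hJ, ⟨q, hqS, hJq⟩, hfol⟩ := exists_foliation_analyticHull hW
    (fun x hx => (hSsub hx).1.2) hSne hS
  have hhullZ : analyticHull W S ⊆ Z := by
    intro x hx
    have : x ∈ Z ∩ W := by
      rw [hZW]
      refine ⟨hx.1, fun i => hx.2 (f i) ⟨hf i, fun z hz => ?_⟩⟩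
      have h1 : z ∈ {z ∈ W | ∀ i, f i z = 0} := hZW ▸ (hSsub hz).1
      exact h1.2 i
    exact this.1
  set A : Set (Cn n) := {x ∈ analyticHull W S | J x ≠ 0 ∧ x ∈ Metric.closedBall z₀ δ} with hA
  have hKball : closure A ⊆ Metric.closedBall z₀ δ :=
    closure_minimal (fun x hx => hx.2.2) Metric.isClosed_closedBall
  have hKhull : closure A ⊆ analyticHull W S := by
    intro x hx
    refine ⟨hδW (hKball hx), fun h hh => ?_⟩
    have hcl : IsClosed (Metric.closedBall z₀ δ ∩ h ⁻¹' {0}) :=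
      (hh.1.continuousOn.mono hδW).preimage_isClosed_of_isClosed Metric.isClosed_closedBall
        isClosed_singleton
    have hAsub : A ⊆ Metric.closedBall z₀ δ ∩ h ⁻¹' {0} :=
      fun y hy => ⟨hy.2.2, hy.1.2 h hh⟩
    exact (closure_minimal hAsub hcl hx).2
  have hKc : IsCompact (closure A) :=
    (isCompact_closedBall z₀ δ).of_isClosed_subset isClosed_closure hKball
  refine ⟨closure A, A, hKc, subset_closure, subset_rfl,
    fun x hx => ⟨hhullZ (hKhull hx), hKball hx⟩, ⟨q, ⟨⟨(hSsub hqS).1.2, fun h hh => hh.2 q hqS⟩,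
      hJq, hNW (hSsub hqS).2⟩, ?_⟩, ?_⟩
  · have h1 := (hSsub hqS).2
    rw [Metric.mem_ball, dist_eq_norm] at h1
    exact h1.trans_le (min_le_left _ _)
  · intro u O M hO hKO hu hM x hx
    refine hu.le_of_forall_mem_boundary_le hKc hO hKO hW (hKball.trans hδW) hJ ?_ hM
      (subset_closure hx) hx.2.1
    rintro z ⟨hzK, hzs⟩ hJz
    obtain ⟨U, hU, hzU, H, hH, hker, hHz, hHU⟩ := hfol z (hKhull hzK) hJz
    have hzb : z ∈ Metric.ball z₀ δ :=
      lt_of_le_of_ne (Metric.mem_closedBall.1 (hKball hzK)) hzs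
    refine ⟨U ∩ Metric.ball z₀ δ, hU.inter Metric.isOpen_ball, ⟨hzU, hzb⟩, H,
      hH.mono inter_subset_left, fun x hx => hker x hx.1, hHz, fun x hx hHx => ?_⟩
    obtain ⟨h1, h2⟩ := hHU x hx.1 hHx
    exact subset_closure ⟨h1, h2, Metric.ball_subset_closedBall hx.2⟩

/-! ### The continuity principle and the boundary -/

/-- The continuity principle: when a compact set satisfying the maximum principle is translated, it
does not leave a pseudoconvex set before its boundary does, because the distance to the complement
is at least that of the boundary. -/
lemma IsPseudoconvex.add_smul_mem {Ω : Set (Cn n)} (hΩ : IsPseudoconvex Ω) (hΩo : IsOpen Ω)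
    (hne : Ωᶜ.Nonempty) {K K₀ A : Set (Cn n)} (hK : IsCompact K) (hK₀ : IsClosed K₀)
    (hKA : K ⊆ closure A)
    (hmax : ∀ (u : Cn n → ℝ) (O : Set (Cn n)) (M : ℝ), IsOpen O → K ⊆ O →
      IsPlurisubharmonicOn u O → (∀ x ∈ K ∩ K₀, u x ≤ M) → ∀ x ∈ A, u x ≤ M)
    (hAK : A ⊆ K) {ν : Cn n} {s₀ s₁ : ℝ} (hs : s₀ ≤ s₁)
    (hbd : ∀ x ∈ K ∩ K₀, ∀ s ∈ Icc s₀ s₁, x + s • ν ∈ Ω)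
    (htop : ∀ x ∈ K, x + s₁ • ν ∈ Ω) : ∀ x ∈ K, x + s₀ • ν ∈ Ω := by
  have hcl : IsClosed Ωᶜ := hΩo.isClosed_compl
  have hpos : ∀ x, x ∈ Ω ↔ 0 < Metric.infDist x Ωᶜ := fun x => by
    rw [← hcl.notMem_iff_infDist_pos hne, notMem_compl_iff]
  have hdc : Continuous fun x => Metric.infDist x Ωᶜ := Metric.continuous_infDist_pt _
  obtain ⟨m, hm, hmb⟩ : ∃ m > 0, ∀ x ∈ K ∩ K₀, ∀ s ∈ Icc s₀ s₁,
      m ≤ Metric.infDist (x + s • ν) Ωᶜ := by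
    have hT : IsCompact ((K ∩ K₀) ×ˢ Icc s₀ s₁) := (hK.inter_right hK₀).prod isCompact_Icc
    rcases ((K ∩ K₀) ×ˢ Icc s₀ s₁).eq_empty_or_nonempty with h | h
    · refine ⟨1, one_pos, fun x hx s hs => ?_⟩
      have : (x, s) ∈ (K ∩ K₀) ×ˢ Icc s₀ s₁ := ⟨hx, hs⟩
      rw [h] at this
      exact this.elim
    · obtain ⟨p, hp, hpmin⟩ := hT.exists_isMinOn h (f := fun p : Cn n × ℝ =>
        Metric.infDist (p.1 + p.2 • ν) Ωᶜ)
        (hdc.comp (by fun_prop : Continuous fun p : Cn n × ℝ => p.1 + p.2 • ν)).continuousOn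
      exact ⟨_, (hpos _).1 (hbd _ hp.1 _ hp.2), fun x hx s hs =>
        isMinOn_iff.1 hpmin (x, s) (mk_mem_prod hx hs)⟩
  -- whenever a translate of `K` lies in `Ω`, its distance to the complement is at least `m`
  have hstep : ∀ s ∈ Icc s₀ s₁, (∀ x ∈ K, x + s • ν ∈ Ω) →
      ∀ x ∈ K, m ≤ Metric.infDist (x + s • ν) Ωᶜ := by
    intro s hs hsK
    have hA : ∀ x ∈ A, m ≤ Metric.infDist (x + s • ν) Ωᶜ := by
      intro x hx
      have h1 := hmax _ {z | z + s • ν ∈ Ω} (-Real.log m)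
        (hΩo.preimage (by fun_prop : Continuous fun z : Cn n => z + s • ν)) hsK
        (hΩ.comp_add_const (s • ν))
        (fun y hy => neg_le_neg (Real.log_le_log hm (hmb y hy s hs))) x hx
      exact (Real.log_le_log_iff hm ((hpos _).1 (hsK x (hAK hx)))).1 (neg_le_neg_iff.1 h1)
    have hclosed : IsClosed {x | m ≤ Metric.infDist (x + s • ν) Ωᶜ} :=
      isClosed_le continuous_const
        (hdc.comp (by fun_prop : Continuous fun z : Cn n => z + s • ν))
    exact fun x hx => closure_minimal hA hclosed (hKA hx)
  have hind : ∀ k : ℕ, ∀ s ∈ Icc s₀ s₁, s₁ - s ≤ k * (m / (‖ν‖ + 1)) →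
      ∀ x ∈ K, x + s • ν ∈ Ω := by
    intro k
    induction k with
    | zero =>
      intro s hs hk
      have : s = s₁ := le_antisymm hs.2 (by simpa using hk)
      rwa [this]
    | succ k ih =>
      intro s hs hk x hx
      set t := min s₁ (s + m / (‖ν‖ + 1)) with ht
      have hm' : 0 < m / (‖ν‖ + 1) := by positivity
      have hst : s ≤ t := le_min hs.2 (by linarith)
      have htI : t ∈ Icc s₀ s₁ := ⟨hs.1.trans hst, min_le_left _ _⟩
      have htk : s₁ - t ≤ k * (m / (‖ν‖ + 1)) := by
        rcases min_choice s₁ (s + m / (‖ν‖ + 1)) with h | h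
        · rw [ht, h, sub_self]; positivity
        · rw [ht, h]; push_cast at hk; linarith
      have h1 := hstep t htI (ih t htI htk) x hx
      have h2 : Metric.infDist (x + t • ν) Ωᶜ
          ≤ Metric.infDist (x + s • ν) Ωᶜ + dist (x + t • ν) (x + s • ν) :=
        Metric.infDist_le_infDist_add_dist
      have h3 : dist (x + t • ν) (x + s • ν) = (t - s) * ‖ν‖ := by
        rw [dist_add_left, dist_eq_norm, ← sub_smul, norm_smul,
          Real.norm_of_nonneg (sub_nonneg.2 hst)]
      have h4 : (t - s) * ‖ν‖ < m := by
        have h5 : t - s ≤ m / (‖ν‖ + 1) := by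
          have := min_le_right s₁ (s + m / (‖ν‖ + 1)); linarith
        calc (t - s) * ‖ν‖ ≤ m / (‖ν‖ + 1) * ‖ν‖ := by gcongr
          _ < m / (‖ν‖ + 1) * (‖ν‖ + 1) := by gcongr; linarith
          _ = m := div_mul_cancel₀ _ (by positivity)
      exact (hpos _).2 (by linarith)
  obtain ⟨k, hk⟩ := exists_nat_ge ((s₁ - s₀) / (m / (‖ν‖ + 1)))
  refine hind k s₀ ⟨le_rfl, hs⟩ ?_
  rwa [div_le_iff₀ (by positivity)] at hk

/-- An inner unit direction `ν` at a boundary point, along which the defining function decreases at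
a definite rate. -/
lemma IsC2DefiningFunctionAt.exists_inner_direction {Ω : Set (Cn n)} (hΩo : IsOpen Ω)
    {r : Cn n → ℝ} {z₀ : Cn n} (hz₀ : z₀ ∈ frontier Ω) (hr : IsC2DefiningFunctionAt Ω r z₀) :
    ∃ (ν : Cn n) (c L ρ : ℝ), ‖ν‖ = 1 ∧ 0 < c ∧ 0 < L ∧ 0 < ρ ∧
      (∀ z ∈ Metric.ball z₀ ρ, z ∈ Ω ↔ r z < 0) ∧
      (∀ z ∈ Metric.ball z₀ ρ, |r z| ≤ L * ‖z - z₀‖) ∧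
      ∀ z ∈ Metric.ball z₀ ρ, ∀ s : ℝ, 0 ≤ s → z + s • ν ∈ Metric.ball z₀ ρ →
        r (z + s • ν) ≤ r z - c * s := by
  obtain ⟨U, hU, hz₀U, hrU, hΩU, hdr⟩ := hr
  have hUn := hU.mem_nhds hz₀U
  have hrc : ContinuousAt r z₀ := hrU.continuousOn.continuousAt hUn
  have hr0 : r z₀ = 0 := by
    refine le_antisymm ?_ ?_
    · by_contra! h
      have h1 : ∀ᶠ z in 𝓝 z₀, 0 < r z := hrc.eventually (lt_mem_nhds h)
      have h2 : ∃ᶠ z in 𝓝 z₀, z ∈ Ω := mem_closure_iff_frequently.1 (frontier_subset_closure hz₀)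
      obtain ⟨z, hz, hz1, hz2⟩ := (h2.and_eventually (h1.and hUn)).exists
      exact lt_asymm hz1 ((hΩU z hz2).1 hz)
    · by_contra! h
      have : z₀ ∈ interior Ω := by
        rw [hΩo.interior_eq]; exact (hΩU z₀ hz₀U).2 h
      exact hz₀.2 this
  obtain ⟨w, hw⟩ : ∃ w, fderiv ℝ r z₀ w ≠ 0 := by
    by_contra! h
    exact hdr z₀ hz₀U hr0 (by ext w; exact h w)
  obtain ⟨D, hD⟩ : ∃ D, D = fderiv ℝ r z₀ := ⟨_, rfl⟩
  rw [← hD] at hw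
  have hw0 : w ≠ 0 := by rintro rfl; simp at hw
  have hwn : 0 < ‖w‖ := norm_pos_iff.2 hw0
  obtain ⟨ν, hν, hDν⟩ : ∃ ν : Cn n, ‖ν‖ = 1 ∧ D ν < 0 := by
    rcases lt_or_gt_of_ne hw with h | h
    · refine ⟨‖w‖⁻¹ • w, by simp [norm_smul, hwn.ne'], ?_⟩
      rw [map_smul, smul_eq_mul]
      exact mul_neg_of_pos_of_neg (by positivity) h
    · refine ⟨-(‖w‖⁻¹ • w), by simp [norm_smul, hwn.ne'], ?_⟩
      rw [map_neg, map_smul, smul_eq_mul, neg_lt_zero]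
      positivity
  have hstrict : HasStrictFDerivAt r D z₀ :=
    hD ▸ (hrU.contDiffAt hUn).hasStrictFDerivAt (by norm_num)
  obtain ⟨c, hc⟩ : ∃ c, c = -(D ν) / 2 := ⟨_, rfl⟩
  have hc0 : 0 < c := by rw [hc]; linarith
  have hlo : ∀ᶠ p : Cn n × Cn n in 𝓝 (z₀, z₀),
      ‖r p.1 - r p.2 - D (p.1 - p.2)‖ ≤ c * ‖p.1 - p.2‖ := hstrict.isLittleO.def hc0
  rw [nhds_prod_eq] at hlo
  obtain ⟨ρ, hρ, hρ'⟩ := Metric.nhds_basis_ball.prod_self.eventually_iff.1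
    (hlo.and (prod_mem_prod hUn hUn))
  have hest : ∀ x ∈ Metric.ball z₀ ρ, ∀ y ∈ Metric.ball z₀ ρ,
      |r x - r y - D (x - y)| ≤ c * ‖x - y‖ := fun x hx y hy =>
    (hρ' (x := (x, y)) ⟨hx, hy⟩).1
  have hz₀b := Metric.mem_ball_self (x := z₀) hρ
  refine ⟨ν, c, ‖D‖ + c, ρ, hν, hc0, by positivity, hρ, fun z hz =>
    hΩU z (hρ' (x := (z, z)) ⟨hz, hz⟩).2.1, fun z hz => ?_, fun z hz s hs hzs => ?_⟩
  · have h1 := hest z hz z₀ hz₀b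
    rw [hr0, sub_zero] at h1
    have h2 : |D (z - z₀)| ≤ ‖D‖ * ‖z - z₀‖ := D.le_opNorm _
    have h3 : |r z| ≤ |r z - D (z - z₀)| + |D (z - z₀)| := by
      simpa using abs_add_le (r z - D (z - z₀)) (D (z - z₀))
    linarith
  · have h1 := (abs_le.1 (hest _ hzs z hz)).2
    rw [add_sub_cancel_left, norm_smul, hν, mul_one, Real.norm_of_nonneg hs, map_smul,
      smul_eq_mul] at h1
    have h2 : D ν = -(2 * c) := by rw [hc]; ring
    rw [h2] at h1
    linarith

lemma le_rpow_inv_mul_of_rpow_le {g t c η : ℝ} (hg : 0 ≤ g) (ht : 0 ≤ t) (hc : 0 ≤ c)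
    (hη : 0 < η) (h : g ^ η ≤ c * t ^ η) : g ≤ c ^ η⁻¹ * t := by
  have h1 := Real.rpow_le_rpow (by positivity) h (inv_nonneg.2 hη.le)
  rwa [Real.rpow_rpow_inv hg hη.ne', Real.mul_rpow hc (by positivity),
    Real.rpow_rpow_inv ht hη.ne'] at h1

end Curve

/-! ### Comparison of the rate with the type -/

theorem theorem2p2 {n : ℕ} (Ω : Set (Cn n)) (hΩo : IsOpen Ω) (hΩc : IsConnected Ω)
    (hΩb : HasC2Boundary Ω) (hΩp : IsPseudoconvex Ω)
    (z₀ : Cn n) (hz₀ : z₀ ∈ frontier Ω)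
    -- the rate `G` is a nonnegative increasing function of small positive numbers
    (G : ℝ → ℝ) (a : ℝ) (ha : 0 < a) (hGmono : MonotoneOn G (Ioo 0 a))
    (hGnonneg : ∀ t ∈ Ioo 0 a, 0 ≤ G t)
    -- the plurisubharmonic function near `z₀`
    (V : Set (Cn n)) (hVo : IsOpen V) (hz₀V : z₀ ∈ V)
    (ψ : Cn n → ℝ) (hψ : IsPlurisubharmonicOn ψ (V ∩ Ω))
    (c₁ c₂ η : ℝ) (hc₁ : 0 < c₁) (hc₂ : 0 < c₂) (hη : η ∈ Ioc (0 : ℝ) 1)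
    (hlower : ∀ z ∈ V ∩ Ω, -c₁ * ‖z - z₀‖ ^ η ≤ ψ z)
    (hupper : ∀ z ∈ V ∩ Ω, ψ z ≤ -(G (c₂ * ‖z - z₀‖)) ^ η)
    -- the type of the boundary along the variety `Z`
    (r : Cn n → ℝ) (hr : IsC2DefiningFunctionAt Ω r z₀)
    (Z : Set (Cn n)) (hZ : IsComplexCurveThrough Z z₀)
    (F : ℝ → ℝ) (hF : HasTypeLEAlong r Z z₀ F) :
    ∃ α > 0, ∃ β > 0, ∀ᶠ δ in 𝓝[>] (0 : ℝ), β * G (α * δ) ≤ F δ := by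
  obtain ⟨ν, c, L, ρ₁, hν, hc, hL, hρ₁, hΩr, hrL, hrν⟩ :=
    hr.exists_inner_direction hΩo hz₀
  obtain ⟨ρ₂, hρ₂, hmaxZ⟩ := hZ.exists_maximum_principle
  obtain ⟨ρ₃, hρ₃, hVball⟩ := Metric.nhds_basis_ball.mem_iff.1 (hVo.mem_nhds hz₀V)
  obtain ⟨ρ₄, hρ₄, hFball⟩ := Metric.eventually_nhds_iff_ball.1 (eventually_nhdsWithin_iff.1 hF)
  have hne : Ωᶜ.Nonempty := ⟨z₀, fun h => hz₀.2 (by rwa [hΩo.interior_eq])⟩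
  have hC : 0 < c₁ ^ η⁻¹ := by positivity
  refine ⟨c₂ / 2, by positivity, c / (2 * c₁ ^ η⁻¹), by positivity, ?_⟩
  -- translations by less than `(L + 1) / c * δ` are used at scale `δ`
  have hsmall : ∀ᶠ δ in 𝓝[>] (0 : ℝ), δ + ((L + 1) / c + 1) * δ < min ρ₁ ρ₃ ∧ δ < ρ₂ ∧ δ < ρ₄ ∧
      c₂ * (2 * δ) < a := by
    have ev : ∀ (k b : ℝ), 0 < b → ∀ᶠ δ in 𝓝[>] (0 : ℝ), k * δ < b := by
      intro k b hb
      have : Tendsto (fun δ : ℝ => k * δ) (𝓝[>] 0) (𝓝 0) := by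
        have h : ContinuousAt (fun δ : ℝ => k * δ) 0 := by fun_prop
        simpa using h.tendsto.mono_left nhdsWithin_le_nhds
      exact this.eventually (gt_mem_nhds hb)
    filter_upwards [ev (1 + ((L + 1) / c + 1)) _ (lt_min hρ₁ hρ₃), ev 1 _ hρ₂, ev 1 _ hρ₄,
      ev (c₂ * 2) _ ha] with δ h1 h2 h3 h4
    exact ⟨by linarith, by linarith, by linarith, by linarith⟩
  filter_upwards [hsmall, self_mem_nhdsWithin] with δ ⟨hδ1, hδ2, hδ4, hδa⟩ hδ0
  replace hδ0 : 0 < δ := hδ0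
  have hLc : 0 ≤ (L + 1) / c * δ := by positivity
  have hδρ₁ : δ + ((L + 1) / c + 1) * δ < ρ₁ := hδ1.trans_le (min_le_left _ _)
  have hδρ₃ : δ + ((L + 1) / c + 1) * δ < ρ₃ := hδ1.trans_le (min_le_right _ _)
  -- the translates of points of the ball of radius `δ`
  have hnorm : ∀ x ∈ Metric.closedBall z₀ δ, ∀ s : ℝ, 0 ≤ s → ‖x + s • ν - z₀‖ ≤ δ + s := by
    intro x hx s hs
    rw [Metric.mem_closedBall, dist_eq_norm] at hx
    calc ‖x + s • ν - z₀‖ = ‖(x - z₀) + s • ν‖ := by congr 1; abel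
      _ ≤ ‖x - z₀‖ + ‖s • ν‖ := norm_add_le _ _
      _ ≤ δ + s := by rw [norm_smul, hν, mul_one, Real.norm_of_nonneg hs]; linarith
  have hmem : ∀ x ∈ Metric.closedBall z₀ δ, ∀ s : ℝ, 0 ≤ s → s ≤ ((L + 1) / c + 1) * δ →
      x + s • ν ∈ Metric.ball z₀ ρ₁ ∧ x + s • ν ∈ V := by
    intro x hx s hs hs'
    have h1 := hnorm x hx s hs
    refine ⟨?_, hVball ?_⟩ <;> rw [Metric.mem_ball, dist_eq_norm] <;> linarith
  have hx₁ : ∀ x ∈ Metric.closedBall z₀ δ, x ∈ Metric.ball z₀ ρ₁ := fun x hx => by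
    simpa using (hmem x hx 0 le_rfl (by positivity)).1
  have hGδ : 0 ≤ G (c₂ / 2 * δ) := hGnonneg _ ⟨by positivity, by linarith⟩
  have hz₀cb : z₀ ∈ Metric.closedBall z₀ δ := Metric.mem_closedBall_self hδ0.le
  have hδs : δ ≤ ((L + 1) / c + 1) * δ := by linarith
  -- `ψ` at `z₀ + (δ / 2) ν` bounds `G` linearly
  have hlin : G (c₂ / 2 * δ) ≤ c₁ ^ η⁻¹ * (δ / 2) := by
    obtain ⟨h1, h2⟩ := hmem z₀ hz₀cb (δ / 2) (by positivity) (by linarith)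
    have h3 : z₀ + (δ / 2) • ν ∈ Ω := by
      refine (hΩr _ h1).2 ?_
      have h4 := hrν z₀ (hx₁ z₀ hz₀cb) (δ / 2) (by positivity) h1
      have h5 := hrL z₀ (hx₁ z₀ hz₀cb)
      rw [sub_self, norm_zero, mul_zero] at h5
      have h6 := le_abs_self (r z₀)
      have h7 : 0 < c * (δ / 2) := by positivity
      linarith
    have h4 : ‖z₀ + (δ / 2) • ν - z₀‖ = δ / 2 := by
      rw [add_sub_cancel_left, norm_smul, hν, mul_one, Real.norm_of_nonneg (by positivity)]
    have h5 := (hlower _ ⟨h2, h3⟩).trans (hupper _ ⟨h2, h3⟩)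
    rw [h4, show c₂ * (δ / 2) = c₂ / 2 * δ by ring] at h5
    exact le_rpow_inv_mul_of_rpow_le hGδ (by positivity) hc₁.le hη.1 (by linarith)
  have hFZ : ∀ x ∈ Z, x ∈ Metric.sphere z₀ δ → |r x| ≤ F δ := by
    intro x hxZ hx
    rw [Metric.mem_sphere] at hx
    have h1 := hFball x (by rw [Metric.mem_ball, hx]; exact hδ4)
      ⟨hxZ, fun h => by rw [mem_singleton_iff.1 h, dist_self] at hx; linarith⟩
    rwa [← dist_eq_norm, hx] at h1
  have hF0 : 0 ≤ F δ := by
    obtain ⟨K, A, -, -, -, hKZ, ⟨q, hqA, -⟩, hmax⟩ := hmaxZ δ ⟨hδ0, hδ2⟩ 1 one_pos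
    by_contra! hneg
    have h1 := hmax (fun _ => 0) univ (-1) isOpen_univ (subset_univ _)
      (isPlurisubharmonicOn_const _ _) (fun x hx =>
        absurd ((abs_nonneg _).trans (hFZ x (hKZ hx.1).1 hx.2)) (not_le.2 hneg)) q hqA
    norm_num at h1
  have hmain : ∀ s, F δ / c < s → s ≤ δ / 2 → G (c₂ / 2 * δ) ≤ c₁ ^ η⁻¹ * (2 * s) := by
    intro s hFs hsδ
    have hs0 : 0 < s := (div_nonneg hF0 hc.le).trans_lt hFs
    obtain ⟨K, A, hK, hAK, hKA, hKZ, ⟨q, hqA, hqs⟩, hmax⟩ := hmaxZ δ ⟨hδ0, hδ2⟩ s hs0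
    have hs₁ : max s ((L + 1) / c * δ) ≤ ((L + 1) / c + 1) * δ :=
      max_le (by linarith) (by linarith)
    have hΩK : ∀ x ∈ K, x + s • ν ∈ Ω := by
      refine hΩp.add_smul_mem hΩo hne hK (Metric.isClosed_sphere (x := z₀) (ε := δ)) hKA hmax hAK
        (le_max_left s ((L + 1) / c * δ)) (fun x hx t ht => ?_) (fun x hx => ?_)
      · have hxb := (hKZ hx.1).2
        have ht0 : 0 ≤ t := hs0.le.trans ht.1
        obtain ⟨h1, -⟩ := hmem x hxb t ht0 (ht.2.trans hs₁)
        refine (hΩr _ h1).2 ?_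
        have h2 := hrν x (hx₁ x hxb) t ht0 h1
        have h3 := (le_abs_self _).trans (hFZ x (hKZ hx.1).1 hx.2)
        have h4 : F δ < c * t := by
          rw [div_lt_iff₀' hc] at hFs
          exact hFs.trans_le (by gcongr; exact ht.1)
        linarith
      · have hxb := (hKZ hx).2
        have ht0 : 0 ≤ max s ((L + 1) / c * δ) := hs0.le.trans (le_max_left _ _)
        obtain ⟨h1, -⟩ := hmem x hxb _ ht0 hs₁
        refine (hΩr _ h1).2 ?_
        have h2 := hrν x (hx₁ x hxb) _ ht0 h1
        have h3 := (le_abs_self _).trans (hrL x (hx₁ x hxb))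
        have h4 : L * ‖x - z₀‖ ≤ L * δ := by
          gcongr
          rwa [Metric.mem_closedBall, dist_eq_norm] at hxb
        have h5 : c * ((L + 1) / c * δ) ≤ c * max s ((L + 1) / c * δ) := by
          gcongr
          exact le_max_right _ _
        have h6 : c * ((L + 1) / c * δ) = L * δ + δ := by field_simp
        linarith
    have hVΩ : ∀ x ∈ K, x + s • ν ∈ V ∩ Ω := fun x hx =>
      ⟨(hmem x (hKZ hx).2 s hs0.le (by linarith)).2, hΩK x hx⟩
    have hψq := hmax _ {z | z + s • ν ∈ V ∩ Ω} (-(G (c₂ / 2 * δ)) ^ η)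
      ((hVo.inter hΩo).preimage (by fun_prop : Continuous fun z : Cn n => z + s • ν)) hVΩ
      (hψ.comp_add_const (s • ν)) (fun x hx => by
        refine (hupper _ (hVΩ x hx.1)).trans (neg_le_neg ?_)
        have h1 := hnorm x (hKZ hx.1).2 s hs0.le
        have h2 : δ / 2 ≤ ‖x + s • ν - z₀‖ := by
          have h3 : ‖x - z₀‖ = δ := by simpa [dist_eq_norm] using hx.2
          have h4 : ‖s • ν‖ = s := by
            rw [norm_smul, hν, mul_one, Real.norm_of_nonneg hs0.le]
          have h5 := norm_sub_le (x + s • ν - z₀) (s • ν)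
          rw [show x + s • ν - z₀ - s • ν = x - z₀ by abel] at h5
          linarith
        have h3 : c₂ / 2 * δ ≤ c₂ * ‖x + s • ν - z₀‖ := by
          rw [div_mul_eq_mul_div, mul_div_assoc]; gcongr
        have h4 : c₂ * ‖x + s • ν - z₀‖ < a :=
          lt_of_le_of_lt (by gcongr; linarith) hδa
        have h5 : 0 < c₂ / 2 * δ := by positivity
        exact Real.rpow_le_rpow hGδ
          (hGmono ⟨h5, h3.trans_lt h4⟩ ⟨h5.trans_le h3, h4⟩ h3) hη.1.le) q hqA
    have hq1 := (hlower _ (hVΩ q (hAK hqA))).trans hψq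
    have hq2 : ‖q + s • ν - z₀‖ ≤ 2 * s := by
      calc ‖q + s • ν - z₀‖ = ‖(q - z₀) + s • ν‖ := by congr 1; abel
        _ ≤ ‖q - z₀‖ + ‖s • ν‖ := norm_add_le _ _
        _ ≤ 2 * s := by rw [norm_smul, hν, mul_one, Real.norm_of_nonneg hs0.le]; linarith
    refine le_rpow_inv_mul_of_rpow_le hGδ (by positivity) hc₁.le hη.1 ?_
    have hq3 : c₁ * ‖q + s • ν - z₀‖ ^ η ≤ c₁ * (2 * s) ^ η := by
      gcongr
      exact hη.1.le
    linarith
  have hfin : G (c₂ / 2 * δ) / (2 * c₁ ^ η⁻¹) ≤ F δ / c := by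
    refine le_of_forall_gt_imp_ge_of_dense fun s hs => ?_
    rw [div_le_iff₀ (by positivity)]
    rcases le_or_gt s (δ / 2) with h | h
    · linarith [hmain s hs h]
    · have : c₁ ^ η⁻¹ * (δ / 2) ≤ c₁ ^ η⁻¹ * s := by gcongr
      have h0 : 0 ≤ c₁ ^ η⁻¹ * s := mul_nonneg hC.le (by linarith)
      linarith
  rw [div_le_div_iff₀ (by positivity) hc] at hfin
  rw [div_mul_eq_mul_div, div_le_iff₀ (by positivity)]
  linarith
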